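/- Let $n\ge 1$ and let $\mathcal F$ be the space of closed subsets of $\mathbb R^n$ (including $\emptyset$) with the Borel $\sigma$-algebra of the hit-or-miss topology, which is generated by the sets $\{F\in\mathcal F: F\cap C=\emptyset,\ F\cap G_1\ne\emptyset,\dots,F\cap G_m\ne\emptyset\}$ with $C$ compact and $G_1,\dots,G_m$ open. A random compact convex set is an $\mathcal F$-valued random element whose realizations are almost surely nonempty, compact and convex. Write $|\cdot|$ for Lebesgue measure on $\mathbb R^n$ and $\|F\|=\sup\{\|x\|:x\in F\}$ for the Euclidean norm $\|x\|$; sums and multiples of sets are in the sense of Minkowski. Let $K,K_1,K_2,\dots$ be random compact convex sets on a probability space such that $K_1,K_2,\dots$ are independent and each $K_i$ has the same distribution as $K$, and suppose that $E\|K\|<\infty$. Let $$EK=\{E\xi:\ \xi \text{ an integrable random vector on this space with } \xi\in K \text{ almost surely}\}$$ be the Aumann expectation of $K$. Then $\left|\frac{K_1+\dots+K_M}{M}\right|^{1/n}$ is integrable for every $M\ge1$, $|EK|<\infty$, the sequence $$E\left[\left|\frac{K_1+\dots+K_M}{M}\right|^{1/n}\right],\qquad M=1,2,\dots,$$ is non-decreasing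 in $M$, and it converges to $|EK|^{1/n}$ as $M\to\infty$. -/

import Mathlib

open MeasureTheory ProbabilityTheory Filter Topology
open scoped Pointwise ENNReal

/-- The Euclidean space `ℝⁿ` with its standard inner product; `volume` on it is Lebesgue measure. -/
abbrev RSpace (n : ℕ) : Type := EuclideanSpace ℝ (Fin n)

/-- The space of all closed subsets of `X`, including the empty set.  This is a type synonym of
Mathlib's type of closed subsets, so that the hit-or-miss topology below does not compete with
the topologies that Mathlib puts on that type. -/
def ClosedSets (X : Type*) [TopologicalSpace X] : Type _ := TopologicalSpace.Closeds X

namespace ClosedSets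

variable {X : Type*} [TopologicalSpace X]

/-- The closed set underlying an element of the space of closed sets. -/
def toSet (F : ClosedSets X) : Set X := TopologicalSpace.Closeds.carrier F

theorem isClosed_toSet (F : ClosedSets X) : IsClosed F.toSet :=
  TopologicalSpace.Closeds.isClosed' F

/-- The basic set of all closed sets that miss `C` and hit every member of `𝒢`. -/
def missHit (C : Set X) (𝒢 : Set (Set X)) : Set (ClosedSets X) :=
  {F | F.toSet ∩ C = ∅ ∧ ∀ G ∈ 𝒢, (F.toSet ∩ G).Nonempty}

/-- The hit-or-miss (Fell) topology: it is generated by the sets of all closed sets that miss a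
given compact set and hit each of finitely many given open sets. -/
instance hitOrMissTopology : TopologicalSpace (ClosedSets X) :=
  TopologicalSpace.generateFrom
    {U | ∃ (C : Set X) (𝒢 : Set (Set X)),
      IsCompact C ∧ 𝒢.Finite ∧ (∀ G ∈ 𝒢, IsOpen G) ∧ U = missHit C 𝒢}

/-- The Borel σ-algebra of the hit-or-miss topology. -/
instance hitOrMissMeasurableSpace : MeasurableSpace (ClosedSets X) := borel (ClosedSets X)

instance hitOrMissBorelSpace : BorelSpace (ClosedSets X) := ⟨rfl⟩

end ClosedSets

/-- The norm `‖F‖ = sup {‖x‖ : x ∈ F}` of a set, with values in `[0, ∞]`. -/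
noncomputable def setNorm {n : ℕ} (F : Set (RSpace n)) : ℝ≥0∞ := ⨆ x ∈ F, ‖x‖ₑ

/-- A random (nonempty) compact convex set in `ℝⁿ`: a random element of the space of closed sets
whose realizations are almost surely nonempty, compact and convex. -/
structure IsRandomCompactConvex {n : ℕ} {Ω : Type*} [MeasurableSpace Ω] (P : Measure Ω)
    (K : Ω → ClosedSets (RSpace n)) : Prop where
  measurable : Measurable K
  ae_nonempty : ∀ᵐ ω ∂P, (K ω).toSet.Nonempty
  ae_isCompact : ∀ᵐ ω ∂P, IsCompact (K ω).toSet
  ae_convex : ∀ᵐ ω ∂P, Convex ℝ (K ω).toSet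

/-- A selector of a random set `A`: a random vector that lies in `A` with probability one. -/
structure IsSelector {n : ℕ} {Ω : Type*} [MeasurableSpace Ω] (P : Measure Ω)
    (A : Ω → ClosedSets (RSpace n)) (ξ : Ω → RSpace n) : Prop where
  measurable : Measurable ξ
  ae_mem : ∀ᵐ ω ∂P, ξ ω ∈ (A ω).toSet

/-- The Aumann expectation `{E ξ : ξ a selector of A whose expectation exists}`. -/
noncomputable def aumannExpectation {n : ℕ} {Ω : Type*} [MeasurableSpace Ω] (P : Measure Ω)
    (A : Ω → ClosedSets (RSpace n)) : Set (RSpace n) :=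
  {x | ∃ ξ : Ω → RSpace n, IsSelector P A ξ ∧ Integrable ξ P ∧ ∫ ω, ξ ω ∂P = x}

/-- The empirical Minkowski mean `(A₁ + ⋯ + A_M) / M` of the first `M` members of a sequence of
random sets; the sequence is indexed from `0`, so `A_{i+1}` is `A i`. -/
noncomputable def empiricalMean {n : ℕ} {Ω : Type*} (A : ℕ → Ω → ClosedSets (RSpace n))
    (M : ℕ) (ω : Ω) : Set (RSpace n) :=
  (M : ℝ)⁻¹ • ∑ i ∈ Finset.range M, (A i ω).toSet

/-- The `n`-th root `|S|^{1/n}` of the volume of a set `S` in `ℝⁿ`. -/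
noncomputable def volumeRadius {n : ℕ} (S : Set (RSpace n)) : ℝ :=
  (volume.real S) ^ (1 / (n : ℝ))

/-! The volume radius `|S|^{1/n}` is positively homogeneous and, by Brunn–Minkowski, superadditive
on nonempty compact sets. Given `M + 1` convex bodies, the `M + 1` Minkowski sums that leave one
body out add up to `M` times the full sum. Superadditivity and equality of laws turn this identity
into monotonicity (`sum_volumeRadius_sum_erase_le`, `integral_volumeRadius_empiricalMean_le_succ`).

For the limit, bodies are replaced by their support functions, which are additive under Minkowski
sums. The support function of the closure of `EK` is the expectation of that of `K`
(`IsRandomCompactConvex.supportFn_closure_aumannExpectation`), so the strong law along a dense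
sequence of directions gives almost sure convergence of support functions, and
`tendsto_volumeRadius_of_tendsto_supportFn` carries it over to volume radii. Since the volume radius
of a mean is at most a constant times the average norm, which converges in `L¹`, the limit passes
through the expectation (`tendsto_integral_of_le_of_tendsto_integral_abs_sub`).

Support functions on a dense sequence also settle measurability and equality of laws, because they
turn Minkowski sums into sums of random elements of `ℕ → ℝ`. Brunn–Minkowski is derived from
Prékopa–Leindler, which is proved by induction on the dimension. -/

/-! ### The Prékopa–Leindler and Brunn–Minkowski inequalities -/

/-- The one-dimensional Brunn–Minkowski inequality for compact sets. -/
theorem volume_add_volume_le_volume_add_of_isCompact {A B : Set ℝ} (hA : IsCompact A)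
    (hB : IsCompact B) (hA₀ : A.Nonempty) (hB₀ : B.Nonempty) :
    volume A + volume B ≤ volume (A + B) := by
  -- With `x = max A` and `y = min B`, the translates `A + y` and `x + B` lie in `A + B` and meet
  -- only at `x + y`.
  obtain ⟨x, hx, hxA⟩ := hA.exists_isGreatest hA₀
  obtain ⟨y, hy, hyB⟩ := hB.exists_isLeast hB₀
  have h1 : volume A = volume ((· + y) '' A) := by simp
  have h2 : volume B = volume ((x + ·) '' B) := by simp
  have hdisj : volume (((· + y) '' A) ∩ ((x + ·) '' B)) = 0 := by
    refine measure_mono_null (t := {x + y}) ?_ (by simp)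
    rintro _ ⟨⟨s, hs, rfl⟩, t, ht, hst⟩
    have := hxA hs
    have := hyB ht
    simp only at hst
    simp only [Set.mem_singleton_iff]
    linarith
  have hm : MeasurableSet ((x + ·) '' B) := (hB.image (by fun_prop)).measurableSet
  rw [h1, h2, ← measure_union_add_inter _ hm, hdisj, add_zero]
  refine measure_mono (Set.union_subset ?_ ?_)
  · rintro _ ⟨s, hs, rfl⟩
    exact Set.add_mem_add hs hy
  · rintro _ ⟨s, hs, rfl⟩
    exact Set.add_mem_add hx hs

/-- The one-dimensional Brunn–Minkowski inequality for measurable sets. -/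
theorem volume_add_volume_le_volume_add {A B : Set ℝ} (hA : MeasurableSet A)
    (hB : MeasurableSet B) (hA₀ : A.Nonempty) (hB₀ : B.Nonempty) :
    volume A + volume B ≤ volume (A + B) := by
  obtain ⟨x, hx⟩ := hA₀
  obtain ⟨y, hy⟩ := hB₀
  rw [hA.measure_eq_iSup_isCompact, hB.measure_eq_iSup_isCompact]
  refine ENNReal.iSup_add_iSup_le fun C D => ?_
  simp only [iSup_and']
  by_cases hC : C ⊆ A ∧ IsCompact C
  swap
  · simp only [hC, iSup_false, bot_eq_zero, zero_add]
    refine iSup_le fun hD => ?_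
    calc volume D = volume ((x + ·) '' D) := by simp
      _ ≤ volume (A + B) := measure_mono (by
        rintro _ ⟨s, hs, rfl⟩; exact Set.add_mem_add hx (hD.1 hs))
  by_cases hD : D ⊆ B ∧ IsCompact D
  swap
  · simp only [hD, iSup_false, bot_eq_zero, add_zero]
    refine iSup_le fun hC => ?_
    calc volume C = volume ((· + y) '' C) := by simp
      _ ≤ volume (A + B) := measure_mono (by
        rintro _ ⟨s, hs, rfl⟩; exact Set.add_mem_add (hC.1 hs) hy)
  simp only [hC, hD, and_self, ciSup_pos]
  -- The approximating compact sets may be empty; inserting `x` and `y` repairs this.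
  calc volume C + volume D ≤ volume (insert x C) + volume (insert y D) := by
        gcongr <;> exact Set.subset_insert _ _
    _ ≤ volume (insert x C + insert y D) :=
        volume_add_volume_le_volume_add_of_isCompact (hC.2.insert x) (hD.2.insert y)
          (Set.insert_nonempty _ _) (Set.insert_nonempty _ _)
    _ ≤ volume (A + B) := measure_mono
        (Set.add_subset_add (Set.insert_subset hx hC.1) (Set.insert_subset hy hD.1))

/-- The layer cake formula for a function with values in `[0, 1]`. -/
theorem lintegral_eq_lintegral_volume_lt_toReal {f : ℝ → ℝ≥0∞} (hf : Measurable f)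
    (hf₁ : ∀ x, f x ≤ 1) :
    ∫⁻ x, f x = ∫⁻ s in Set.Ioi (0 : ℝ), volume {x | s < (f x).toReal} := by
  rw [← lintegral_eq_lintegral_meas_lt volume (Eventually.of_forall fun _ => ENNReal.toReal_nonneg)
    hf.ennreal_toReal.aemeasurable]
  refine lintegral_congr fun x => ?_
  rw [ENNReal.ofReal_toReal (ne_top_of_le_ne_top ENNReal.one_ne_top (hf₁ x))]

/-- The additive form of the Prékopa–Leindler inequality on the line, for functions whose supremum
is `1`. -/
theorem prekopa_leindler_real_of_iSup_eq_one {a b : ℝ} (ha : 0 < a) (hb : 0 < b) (hab : a + b = 1)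
    {f g h : ℝ → ℝ≥0∞} (hf : Measurable f) (hg : Measurable g) (hh : Measurable h)
    (hf₁ : ⨆ x, f x = 1) (hg₁ : ⨆ x, g x = 1)
    (H : ∀ x y, f x ^ a * g y ^ b ≤ h (a * x + b * y)) :
    ENNReal.ofReal a * (∫⁻ x, f x) + ENNReal.ofReal b * (∫⁻ x, g x) ≤ ∫⁻ x, h x := by
  have hf' : ∀ x, f x ≤ 1 := fun x => hf₁ ▸ le_iSup f x
  have hg' : ∀ x, g x ≤ 1 := fun x => hg₁ ▸ le_iSup g x
  have hlev : ∀ {φ : ℝ → ℝ≥0∞} {s : ℝ}, 0 < s → (∀ x, φ x ≤ 1) → ∀ x,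
      (s < (φ x).toReal ↔ ENNReal.ofReal s < φ x) := fun {φ s} hs hφ x =>
    (ENNReal.ofReal_lt_iff_lt_toReal hs.le (ne_top_of_le_ne_top ENNReal.one_ne_top (hφ x))).symm
  -- Only levels below `1` matter, so `h` may be cut off at `1`.
  refine le_trans ?_ (lintegral_mono fun x => min_le_left (h x) 1)
  have hm : ∀ x, min (h x) 1 ≤ 1 := fun x => min_le_right _ _
  rw [lintegral_eq_lintegral_volume_lt_toReal hf hf', lintegral_eq_lintegral_volume_lt_toReal hg hg',
    lintegral_eq_lintegral_volume_lt_toReal (hh.min measurable_const) hm,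
    ← lintegral_const_mul' _ _ ENNReal.ofReal_ne_top, ← lintegral_const_mul' _ _ ENNReal.ofReal_ne_top]
  refine (le_lintegral_add _ _).trans (setLIntegral_mono' measurableSet_Ioi fun s hs => ?_)
  rw [Set.mem_Ioi] at hs
  simp only [hlev hs hf', hlev hs hg', hlev hs hm]
  rcases le_or_gt 1 s with hs1 | hs1
  · have h1 : 1 ≤ ENNReal.ofReal s := by simpa using hs1
    have hfe : {x | ENNReal.ofReal s < f x} = ∅ :=
      Set.eq_empty_of_forall_notMem fun x hx => ((h1.trans_lt hx).trans_le (hf' x)).false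
    have hge : {x | ENNReal.ofReal s < g x} = ∅ :=
      Set.eq_empty_of_forall_notMem fun x hx => ((h1.trans_lt hx).trans_le (hg' x)).false
    simp [hfe, hge]
  -- Below level `1` both superlevel sets are nonempty because the suprema equal `1`; this is why
  -- the functions are normalized.
  have h1 : ENNReal.ofReal s < 1 := by simpa using hs1
  have hfn : {x | ENNReal.ofReal s < f x}.Nonempty := by
    rw [← hf₁] at h1
    exact lt_iSup_iff.1 h1
  have hgn : {x | ENNReal.ofReal s < g x}.Nonempty := by
    rw [← hg₁] at h1
    exact lt_iSup_iff.1 h1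
  have hfm : MeasurableSet {x | ENNReal.ofReal s < f x} := measurableSet_lt measurable_const hf
  have hgm : MeasurableSet {x | ENNReal.ofReal s < g x} := measurableSet_lt measurable_const hg
  calc ENNReal.ofReal a * volume {x | ENNReal.ofReal s < f x}
        + ENNReal.ofReal b * volume {x | ENNReal.ofReal s < g x}
      = volume (a • {x | ENNReal.ofReal s < f x}) + volume (b • {x | ENNReal.ofReal s < g x}) := by
        simp [Measure.addHaar_smul, abs_of_pos ha, abs_of_pos hb]
    _ ≤ volume (a • {x | ENNReal.ofReal s < f x} + b • {x | ENNReal.ofReal s < g x}) :=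
        volume_add_volume_le_volume_add (hfm.const_smul₀ a) (hgm.const_smul₀ b)
          hfn.smul_set hgn.smul_set
    _ ≤ volume {x | ENNReal.ofReal s < min (h x) 1} := by
        refine measure_mono ?_
        rintro _ ⟨_, ⟨x, hx, rfl⟩, _, ⟨y, hy, rfl⟩, rfl⟩
        refine lt_min ?_ h1
        refine lt_of_lt_of_le ?_ (H x y)
        have hs0 : ENNReal.ofReal s ≠ 0 := by simpa using hs
        calc ENNReal.ofReal s = ENNReal.ofReal s ^ a * ENNReal.ofReal s ^ b := by
              rw [← ENNReal.rpow_add _ _ hs0 ENNReal.ofReal_ne_top, hab, ENNReal.rpow_one]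
          _ < f x ^ a * g y ^ b :=
              ENNReal.mul_lt_mul (ENNReal.rpow_lt_rpow hx ha) (ENNReal.rpow_lt_rpow hy hb)

/-- The weighted inequality of arithmetic and geometric means in `[0, ∞]`. -/
theorem ENNReal.rpow_mul_rpow_le_ofReal_mul_add {a b : ℝ} (ha : 0 < a) (hb : 0 < b)
    (hab : a + b = 1) (x y : ℝ≥0∞) :
    x ^ a * y ^ b ≤ ENNReal.ofReal a * x + ENNReal.ofReal b * y := by
  have ha' : ENNReal.ofReal a ≠ 0 := by simpa using ha
  have hb' : ENNReal.ofReal b ≠ 0 := by simpa using hb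
  rcases eq_or_ne x ∞ with rfl | hx
  · simp [ENNReal.mul_top ha']
  rcases eq_or_ne y ∞ with rfl | hy
  · simp [ENNReal.mul_top hb']
  have := Real.geom_mean_le_arith_mean2_weighted ha.le hb.le
    (ENNReal.toReal_nonneg (a := x)) (ENNReal.toReal_nonneg (a := y)) hab
  have h2 := ENNReal.ofReal_le_ofReal this
  rwa [ENNReal.ofReal_mul (by positivity), ENNReal.ofReal_add (by positivity) (by positivity),
    ENNReal.ofReal_mul ha.le, ENNReal.ofReal_mul hb.le, ← ENNReal.ofReal_rpow_of_nonneg (by simp) ha.le,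
    ← ENNReal.ofReal_rpow_of_nonneg (by simp) hb.le, ENNReal.ofReal_toReal hx,
    ENNReal.ofReal_toReal hy] at h2

/-- The Prékopa–Leindler inequality on the line, for bounded functions. -/
theorem prekopa_leindler_real_of_iSup_ne_top {a b : ℝ} (ha : 0 < a) (hb : 0 < b) (hab : a + b = 1)
    {f g h : ℝ → ℝ≥0∞} (hf : Measurable f) (hg : Measurable g) (hh : Measurable h)
    (hf₁ : ⨆ x, f x ≠ ∞) (hg₁ : ⨆ x, g x ≠ ∞)
    (H : ∀ x y, f x ^ a * g y ^ b ≤ h (a * x + b * y)) :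
    (∫⁻ x, f x) ^ a * (∫⁻ x, g x) ^ b ≤ ∫⁻ x, h x := by
  set p := ⨆ x, f x with hp
  set q := ⨆ x, g x with hq
  rcases eq_or_ne p 0 with hp0 | hp0
  · have : ∀ x, f x = 0 := fun x => le_antisymm (hp0 ▸ le_iSup f x) bot_le
    simp [this, ha]
  rcases eq_or_ne q 0 with hq0 | hq0
  · have : ∀ x, g x = 0 := fun x => le_antisymm (hq0 ▸ le_iSup g x) bot_le
    simp [this, hb]
  have hpa0 : p ^ a ≠ 0 := (ENNReal.rpow_pos (pos_iff_ne_zero.2 hp0) hf₁).ne'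
  have hqb0 : q ^ b ≠ 0 := (ENNReal.rpow_pos (pos_iff_ne_zero.2 hq0) hg₁).ne'
  have hpa : p ^ a ≠ ∞ := ENNReal.rpow_ne_top_of_nonneg ha.le hf₁
  have hqb : q ^ b ≠ ∞ := ENNReal.rpow_ne_top_of_nonneg hb.le hg₁
  -- Dividing `f`, `g`, `h` by `p`, `q`, `p ^ a * q ^ b` preserves the hypothesis and normalizes the
  -- suprema. Arithmetic-geometric means then turn the additive bound into the multiplicative one.
  have key := prekopa_leindler_real_of_iSup_eq_one ha hb hab (f := fun x => p⁻¹ * f x)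
    (g := fun x => q⁻¹ * g x) (h := fun x => (p ^ a)⁻¹ * (q ^ b)⁻¹ * h x)
    (hf.const_mul _) (hg.const_mul _) (hh.const_mul _)
    (by rw [← ENNReal.mul_iSup, ← hp, ENNReal.inv_mul_cancel hp0 hf₁])
    (by rw [← ENNReal.mul_iSup, ← hq, ENNReal.inv_mul_cancel hq0 hg₁])
    (fun x y => by
      rw [ENNReal.mul_rpow_of_nonneg _ _ ha.le, ENNReal.mul_rpow_of_nonneg _ _ hb.le,
        ENNReal.inv_rpow, ENNReal.inv_rpow, mul_mul_mul_comm]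
      gcongr
      exact H x y)
  have hc : (p ^ a)⁻¹ * (q ^ b)⁻¹ ≠ ∞ := ENNReal.mul_ne_top (by simpa using hpa0) (by simpa using hqb0)
  rw [lintegral_const_mul' _ _ (by simpa using hp0), lintegral_const_mul' _ _ (by simpa using hq0),
    lintegral_const_mul' _ _ hc] at key
  have key2 := (ENNReal.rpow_mul_rpow_le_ofReal_mul_add ha hb hab _ _).trans key
  rw [ENNReal.mul_rpow_of_nonneg _ _ ha.le, ENNReal.mul_rpow_of_nonneg _ _ hb.le,
    ENNReal.inv_rpow, ENNReal.inv_rpow, mul_mul_mul_comm] at key2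
  have hc0 : (p ^ a)⁻¹ * (q ^ b)⁻¹ ≠ 0 := mul_ne_zero (by simpa using hpa) (by simpa using hqb)
  exact (ENNReal.mul_le_mul_iff_right hc0 hc).1 key2

/-- The Prékopa–Leindler inequality on the line. -/
theorem prekopa_leindler_real {a b : ℝ} (ha : 0 < a) (hb : 0 < b) (hab : a + b = 1)
    {f g h : ℝ → ℝ≥0∞} (hf : Measurable f) (hg : Measurable g) (hh : Measurable h)
    (H : ∀ x y, f x ^ a * g y ^ b ≤ h (a * x + b * y)) :
    (∫⁻ x, f x) ^ a * (∫⁻ x, g x) ^ b ≤ ∫⁻ x, h x := by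
  have htrunc : ∀ {φ : ℝ → ℝ≥0∞}, Measurable φ →
      Tendsto (fun k : ℕ => ∫⁻ x, min (φ x) k) atTop (𝓝 (∫⁻ x, φ x)) := by
    intro φ hφ
    refine lintegral_tendsto_of_tendsto_of_monotone
      (fun k => (hφ.min measurable_const).aemeasurable) ?_ ?_
    · exact Eventually.of_forall fun x k l hkl => min_le_min_left _ (by exact_mod_cast hkl)
    · refine Eventually.of_forall fun x => ?_
      have := (tendsto_const_nhds (x := φ x)).min ENNReal.tendsto_nat_nhds_top
      simpa using this
  have hbd : ∀ (φ : ℝ → ℝ≥0∞) (k : ℕ), ⨆ x, min (φ x) (k : ℝ≥0∞) ≠ ∞ := fun φ k =>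
    ne_top_of_le_ne_top (ENNReal.natCast_ne_top k) (iSup_le fun x => min_le_right _ _)
  have hk : ∀ k : ℕ, (∫⁻ x, min (f x) k) ^ a * (∫⁻ x, min (g x) k) ^ b ≤ ∫⁻ x, h x := fun k =>
    prekopa_leindler_real_of_iSup_ne_top ha hb hab (hf.min measurable_const)
      (hg.min measurable_const) hh (hbd f k) (hbd g k) fun x y =>
        (mul_le_mul' (ENNReal.rpow_le_rpow (min_le_left _ _) ha.le)
          (ENNReal.rpow_le_rpow (min_le_left _ _) hb.le)).trans (H x y)
  -- Multiplication in `[0, ∞]` is discontinuous at `(0, ∞)`, so vanishing integrals are treated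
  -- separately before the limit in `k`.
  rcases eq_or_ne (∫⁻ x, f x) 0 with hf0 | hf0
  · simp [hf0, ha]
  rcases eq_or_ne (∫⁻ x, g x) 0 with hg0 | hg0
  · simp [hg0, hb]
  refine le_of_tendsto' (ENNReal.Tendsto.mul ((htrunc hf).ennrpow_const a) (Or.inl ?_)
    ((htrunc hg).ennrpow_const b) (Or.inl ?_)) hk
  · simpa [ENNReal.rpow_eq_zero_iff, ha.le, ha] using hf0
  · simpa [ENNReal.rpow_eq_zero_iff, hb.le, hb] using hg0

/-- The Prékopa–Leindler inequality in `ℝⁿ`. -/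
theorem prekopa_leindler {a b : ℝ} (ha : 0 < a) (hb : 0 < b) (hab : a + b = 1) (n : ℕ)
    {f g h : (Fin n → ℝ) → ℝ≥0∞} (hf : Measurable f) (hg : Measurable g) (hh : Measurable h)
    (H : ∀ x y, f x ^ a * g y ^ b ≤ h (a • x + b • y)) :
    (∫⁻ x, f x) ^ a * (∫⁻ x, g x) ^ b ≤ ∫⁻ x, h x := by
  induction n with
  | zero =>
    have hd : ∀ φ : (Fin 0 → ℝ) → ℝ≥0∞, ∫⁻ x, φ x = φ 0 := fun φ => by
      rw [lintegral_unique]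
      simp only [Measure.volume_pi_eq_dirac (0 : Fin 0 → ℝ), measure_univ, mul_one]
      exact congrArg φ (Subsingleton.elim _ _)
    simpa [hd] using H 0 0
  | succ n ih =>
    set e := (MeasurableEquiv.piFinSuccAbove (fun _ : Fin (n + 1) => ℝ) 0).symm with he
    have hvol := (volume_preserving_piFinSuccAbove (fun _ : Fin (n + 1) => ℝ) 0).symm
    have hfub : ∀ {φ : (Fin (n + 1) → ℝ) → ℝ≥0∞}, Measurable φ →
        ∫⁻ x, φ x = ∫⁻ s, ∫⁻ z, φ (e (s, z)) := by
      intro φ hφ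
      rw [← hvol.lintegral_comp_emb e.measurableEmbedding]
      exact lintegral_prod _ (hφ.comp e.measurable).aemeasurable
    have hmarg : ∀ {φ : (Fin (n + 1) → ℝ) → ℝ≥0∞}, Measurable φ →
        Measurable fun s => ∫⁻ z, φ (e (s, z)) := fun hφ =>
      (hφ.comp e.measurable).lintegral_prod_right'
    have hsec : ∀ {φ : (Fin (n + 1) → ℝ) → ℝ≥0∞}, Measurable φ → ∀ s,
        Measurable fun z => φ (e (s, z)) := fun hφ s =>
      hφ.comp (e.measurable.comp measurable_prodMk_left)
    have hlin : ∀ (s t : ℝ) (z w : Fin n → ℝ),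
        a • e (s, z) + b • e (t, w) = e (a * s + b * t, a • z + b • w) := by
      intro s t z w
      ext i
      refine Fin.cases ?_ (fun j => ?_) i <;>
        simp [he, MeasurableEquiv.piFinSuccAbove, Fin.insertNthEquiv]
    rw [hfub hf, hfub hg, hfub hh]
    -- The inductive hypothesis on sections shows that the marginals in the first coordinate satisfy
    -- the one-dimensional hypothesis.
    refine prekopa_leindler_real ha hb hab (hmarg hf) (hmarg hg) (hmarg hh) fun s t => ?_
    refine ih (hsec hf s) (hsec hg t) (hsec hh _) fun z w => ?_
    rw [← hlin]
    exact H _ _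

/-- The multiplicative form of the Brunn–Minkowski inequality, for compact sets. -/
theorem volume_rpow_mul_volume_rpow_le {n : ℕ} {a b : ℝ} (ha : 0 < a) (hb : 0 < b) (hab : a + b = 1)
    {A B : Set (RSpace n)} (hA : IsCompact A) (hB : IsCompact B) :
    volume A ^ a * volume B ^ b ≤ volume (a • A + b • B) := by
  have hvol := PiLp.volume_preserving_toLp (Fin n)
  have hint : ∀ {S : Set (RSpace n)}, IsCompact S → volume S =
      ∫⁻ x, (WithLp.toLp 2 ⁻¹' S : Set (Fin n → ℝ)).indicator 1 x := fun hS => by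
    rw [lintegral_indicator_one (hvol.measurable hS.measurableSet),
      hvol.measure_preimage hS.measurableSet.nullMeasurableSet]
  have hm : ∀ {S : Set (RSpace n)}, IsCompact S →
      Measurable ((WithLp.toLp 2 ⁻¹' S : Set (Fin n → ℝ)).indicator (1 : (Fin n → ℝ) → ℝ≥0∞)) :=
    fun hS => measurable_one.indicator (hvol.measurable hS.measurableSet)
  have hS : IsCompact (a • A + b • B) := (hA.smul a).add (hB.smul b)
  rw [hint hA, hint hB, hint hS]
  -- For indicators the hypothesis only says that `a • x + b • y` lies in `a • A + b • B` when `x ∈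
  -- A` and `y ∈ B`.
  refine prekopa_leindler ha hb hab n (hm hA) (hm hB) (hm hS) fun x y => ?_
  by_cases hx : WithLp.toLp 2 x ∈ A
  swap
  · simp [hx, ha]
  by_cases hy : WithLp.toLp 2 y ∈ B
  swap
  · simp [hy, hb]
  have : WithLp.toLp 2 (a • x + b • y) ∈ a • A + b • B :=
    Set.add_mem_add (Set.smul_mem_smul_set hx) (Set.smul_mem_smul_set hy)
  simp only [Set.indicator, Set.mem_preimage, hx, hy, this]
  simp

/-! ### The volume radius and its superadditivity. -/

theorem volumeRadius_nonneg {n : ℕ} (S : Set (RSpace n)) : 0 ≤ volumeRadius S :=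
  Real.rpow_nonneg measureReal_nonneg _

theorem volumeRadius_mono {n : ℕ} {S T : Set (RSpace n)} (h : S ⊆ T) (hT : volume T ≠ ∞) :
    volumeRadius S ≤ volumeRadius T :=
  Real.rpow_le_rpow measureReal_nonneg (measureReal_mono h hT) (by positivity)

theorem volumeRadius_pow {n : ℕ} (hn : n ≠ 0) (S : Set (RSpace n)) :
    volumeRadius S ^ n = volume.real S := by
  rw [volumeRadius, one_div, Real.rpow_inv_natCast_pow measureReal_nonneg hn]

theorem le_volumeRadius_iff {n : ℕ} (hn : n ≠ 0) {S : Set (RSpace n)} {c : ℝ} (hc : 0 ≤ c) :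
    c ≤ volumeRadius S ↔ c ^ n ≤ volume.real S := by
  rw [← volumeRadius_pow hn, pow_le_pow_iff_left₀ hc (volumeRadius_nonneg S) hn]

theorem volumeReal_smul {n : ℕ} {c : ℝ} (hc : 0 ≤ c) (S : Set (RSpace n)) :
    volume.real (c • S) = c ^ n * volume.real S := by
  rw [measureReal_def, Measure.addHaar_smul, finrank_euclideanSpace_fin,
    abs_of_nonneg (pow_nonneg hc n), ENNReal.toReal_mul, ENNReal.toReal_ofReal (pow_nonneg hc n),
    measureReal_def]

theorem volumeRadius_smul {n : ℕ} (hn : n ≠ 0) {c : ℝ} (hc : 0 ≤ c) (S : Set (RSpace n)) :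
    volumeRadius (c • S) = c * volumeRadius S := by
  rw [volumeRadius, volumeReal_smul hc, Real.mul_rpow (by positivity) measureReal_nonneg, one_div,
    Real.pow_rpow_inv_natCast hc hn, volumeRadius, one_div]

theorem volumeRadius_vadd {n : ℕ} (x : RSpace n) (S : Set (RSpace n)) :
    volumeRadius ({x} + S) = volumeRadius S := by
  simp [volumeRadius, measureReal_def]

/-- The Brunn–Minkowski inequality for compact sets. -/
theorem volumeRadius_add_le {n : ℕ} (hn : n ≠ 0) {A B : Set (RSpace n)} (hA : IsCompact A)
    (hB : IsCompact B) (hA₀ : A.Nonempty) (hB₀ : B.Nonempty) :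
    volumeRadius A + volumeRadius B ≤ volumeRadius (A + B) := by
  have htop : volume (A + B) ≠ ∞ := (hA.add hB).measure_ne_top
  -- If one radius vanishes, `A + B` still contains a translate of the other set.
  rcases (volumeRadius_nonneg A).eq_or_lt with h0 | hα
  · obtain ⟨x, hx⟩ := hA₀
    rw [← h0, zero_add, ← volumeRadius_vadd x]
    exact volumeRadius_mono (Set.add_subset_add_right (by simpa using hx)) htop
  rcases (volumeRadius_nonneg B).eq_or_lt with h0 | hβ
  · obtain ⟨x, hx⟩ := hB₀
    rw [← h0, add_zero, ← volumeRadius_vadd x, add_comm]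
    exact volumeRadius_mono (Set.add_subset_add_left (by simpa using hx)) htop
  set α := volumeRadius A with hαdef
  set β := volumeRadius B with hβdef
  have hone : ∀ {S : Set (RSpace n)}, IsCompact S → 0 < volumeRadius S →
      volume ((volumeRadius S)⁻¹ • S) = 1 := by
    intro S hS h
    have : volume.real ((volumeRadius S)⁻¹ • S) = 1 := by
      rw [volumeReal_smul (by positivity), ← volumeRadius_pow hn, ← mul_pow,
        inv_mul_cancel₀ h.ne', one_pow]
    rwa [measureReal_def, ENNReal.toReal_eq_one_iff] at this
  -- Both sets are scaled to volume `1`, and the weights are proportional to the radii, so that the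
  -- combination is `(α + β)⁻¹ • (A + B)`.
  have key := volume_rpow_mul_volume_rpow_le (a := α / (α + β)) (b := β / (α + β)) (by positivity)
    (by positivity) (by field_simp) (hA.smul α⁻¹) (hB.smul β⁻¹)
  rw [hone hA hα, hone hB hβ, ENNReal.one_rpow, ENNReal.one_rpow, one_mul, smul_smul, smul_smul,
    show α / (α + β) * α⁻¹ = (α + β)⁻¹ by field_simp,
    show β / (α + β) * β⁻¹ = (α + β)⁻¹ by field_simp, ← smul_add] at key
  have h2 : 1 ≤ volume.real ((α + β)⁻¹ • (A + B)) := by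
    have := ENNReal.toReal_mono (((hA.add hB).smul (α + β)⁻¹).measure_ne_top (μ := volume)) key
    rwa [ENNReal.toReal_one] at this
  rw [volumeReal_smul (by positivity), inv_pow, ← div_eq_inv_mul, one_le_div (by positivity)] at h2
  exact (le_volumeRadius_iff hn (by positivity)).2 h2

/-! ### Minkowski sums of finite families. -/

section FinsetSum

variable {n : ℕ} {ι : Type*}

theorem isCompact_finsetSum {A : ι → Set (RSpace n)} {s : Finset ι} (hA : ∀ i ∈ s, IsCompact (A i)) :
    IsCompact (∑ i ∈ s, A i) :=
  Finset.sum_induction A IsCompact (fun _ _ => IsCompact.add) isCompact_singleton hA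

theorem nonempty_finsetSum {A : ι → Set (RSpace n)} {s : Finset ι} (hA : ∀ i ∈ s, (A i).Nonempty) :
    (∑ i ∈ s, A i).Nonempty :=
  Finset.sum_induction A Set.Nonempty (fun _ _ => Set.Nonempty.add) (Set.singleton_nonempty 0) hA

theorem convex_finsetSum {A : ι → Set (RSpace n)} {s : Finset ι} (hA : ∀ i ∈ s, Convex ℝ (A i)) :
    Convex ℝ (∑ i ∈ s, A i) :=
  Finset.sum_induction A (Convex ℝ) (fun _ _ => Convex.add) (convex_singleton 0) hA

/-- The Brunn–Minkowski inequality for finitely many compact sets. -/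
theorem sum_volumeRadius_le (hn : n ≠ 0) {A : ι → Set (RSpace n)} (s : Finset ι)
    (hA : ∀ i ∈ s, IsCompact (A i)) (hA₀ : ∀ i ∈ s, (A i).Nonempty) :
    ∑ i ∈ s, volumeRadius (A i) ≤ volumeRadius (∑ i ∈ s, A i) := by
  classical
  induction s using Finset.induction_on with
  | empty => simpa using volumeRadius_nonneg _
  | insert i s his ih =>
    rw [Finset.forall_mem_insert] at hA hA₀
    rw [Finset.sum_insert his, Finset.sum_insert his]
    exact (add_le_add_right (ih hA.2 hA₀.2) _).trans
      (volumeRadius_add_le hn hA.1 (isCompact_finsetSum hA.2) hA₀.1 (nonempty_finsetSum hA₀.2))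

/-- Convexity gives `k • A + A = (k + 1) • A`; nonemptiness is needed at `k = 0`, where the empty
sum is `{0}`. -/
theorem Convex.sum_range_const_eq_smul {A : Set (RSpace n)} (hA : Convex ℝ A) (hA₀ : A.Nonempty) (k : ℕ) :
    ∑ _i ∈ Finset.range k, A = (k : ℝ) • A := by
  induction k with
  | zero => simp [Set.zero_smul_set hA₀]
  | succ k ih =>
    rw [Finset.sum_range_succ, ih, Nat.cast_succ, hA.add_smul (by positivity) zero_le_one, one_smul]

/-- Summing the Minkowski sums with one summand left out multiplies the whole Minkowski sum. -/
theorem sum_sum_erase_eq_smul [DecidableEq ι] {A : ι → Set (RSpace n)} (s : Finset ι)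
    (hA : ∀ i ∈ s, Convex ℝ (A i)) (hA₀ : ∀ i ∈ s, (A i).Nonempty) :
    ∑ i ∈ s, ∑ j ∈ s.erase i, A j = ((s.card - 1 : ℕ) : ℝ) • ∑ j ∈ s, A j := by
  -- The multiple is read as a sum of `card - 1` copies; each `A j` occurs in exactly `card - 1` of
  -- the sums with one summand left out.
  rw [← (convex_finsetSum hA).sum_range_const_eq_smul (nonempty_finsetSum hA₀), Finset.sum_comm' (t' := s)
    (s' := fun j => s.erase j), Finset.sum_comm]
  · refine Finset.sum_congr rfl fun j hj => ?_
    rw [Finset.sum_const, Finset.sum_const, Finset.card_range, Finset.card_erase_of_mem hj]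
  · intro i j
    simp only [Finset.mem_erase]
    grind

/-- The volume radius of a Minkowski sum dominates the average over the sums with one summand left
out. -/
theorem sum_volumeRadius_sum_erase_le [DecidableEq ι] (hn : n ≠ 0) {A : ι → Set (RSpace n)}
    (s : Finset ι) (hA : ∀ i ∈ s, IsCompact (A i)) (hA₀ : ∀ i ∈ s, (A i).Nonempty)
    (hAc : ∀ i ∈ s, Convex ℝ (A i)) :
    ∑ i ∈ s, volumeRadius (∑ j ∈ s.erase i, A j) ≤
      ((s.card - 1 : ℕ) : ℝ) * volumeRadius (∑ j ∈ s, A j) := by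
  rw [← volumeRadius_smul hn (Nat.cast_nonneg _), ← sum_sum_erase_eq_smul s hAc hA₀]
  exact sum_volumeRadius_le hn s
    (fun i _ => isCompact_finsetSum fun j hj => hA j (Finset.mem_of_mem_erase hj))
    (fun i _ => nonempty_finsetSum fun j hj => hA₀ j (Finset.mem_of_mem_erase hj))

end FinsetSum

/-! ### Support functions -/

/-- The support function `u ↦ sup {⟪x, u⟫ : x ∈ F}` of a set. -/
noncomputable def supportFn {n : ℕ} (F : Set (RSpace n)) (u : RSpace n) : ℝ :=
  (⨆ x ∈ F, ((inner ℝ x u : ℝ) : EReal)).toReal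

section SupportFn

variable {n : ℕ} {A B F : Set (RSpace n)} {u v x : RSpace n}

theorem supportFn_eq_of_isGreatest {c : ℝ}
    (h : IsGreatest ((fun x : RSpace n => (inner ℝ x u : ℝ)) '' F) c) : supportFn F u = c := by
  obtain ⟨⟨x, hx, rfl⟩, hub⟩ := h
  have : (⨆ y ∈ F, ((inner ℝ y u : ℝ) : EReal)) = ((inner ℝ x u : ℝ) : EReal) := by
    refine le_antisymm (iSup₂_le fun y hy => ?_)
      (le_iSup₂ (f := fun (y : RSpace n) (_ : y ∈ F) => ((inner ℝ y u : ℝ) : EReal)) x hx)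
    exact EReal.coe_le_coe_iff.2 (hub ⟨y, hy, rfl⟩)
  rw [supportFn, this, EReal.toReal_coe]

theorem isGreatest_supportFn (hF : IsCompact F) (hF₀ : F.Nonempty) (u : RSpace n) :
    IsGreatest ((fun x : RSpace n => (inner ℝ x u : ℝ)) '' F) (supportFn F u) := by
  obtain ⟨c, hc⟩ := (hF.image (f := fun x : RSpace n => (inner ℝ x u : ℝ))
    (by fun_prop)).exists_isGreatest (hF₀.image _)
  rwa [supportFn_eq_of_isGreatest hc]

theorem inner_le_supportFn (hF : IsCompact F) (hx : x ∈ F) (u : RSpace n) :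
    inner ℝ x u ≤ supportFn F u :=
  (isGreatest_supportFn hF ⟨x, hx⟩ u).2 ⟨x, hx, rfl⟩

theorem exists_inner_eq_supportFn (hF : IsCompact F) (hF₀ : F.Nonempty) (u : RSpace n) :
    ∃ x ∈ F, inner ℝ x u = supportFn F u :=
  (isGreatest_supportFn hF hF₀ u).1

theorem supportFn_le_iff (hF : IsCompact F) (hF₀ : F.Nonempty) {c : ℝ} :
    supportFn F u ≤ c ↔ ∀ x ∈ F, inner ℝ x u ≤ c := by
  refine ⟨fun h x hx => (inner_le_supportFn hF hx u).trans h, fun h => ?_⟩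
  obtain ⟨x, hx, hxu⟩ := exists_inner_eq_supportFn hF hF₀ u
  exact hxu ▸ h x hx

theorem supportFn_add (hA : IsCompact A) (hA₀ : A.Nonempty) (hB : IsCompact B) (hB₀ : B.Nonempty)
    (u : RSpace n) : supportFn (A + B) u = supportFn A u + supportFn B u := by
  obtain ⟨x, hx, hxu⟩ := exists_inner_eq_supportFn hA hA₀ u
  obtain ⟨y, hy, hyu⟩ := exists_inner_eq_supportFn hB hB₀ u
  refine supportFn_eq_of_isGreatest ⟨⟨x + y, Set.add_mem_add hx hy, ?_⟩, ?_⟩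
  · simp only [inner_add_left, hxu, hyu]
  · rintro _ ⟨_, ⟨s, hs, t, ht, rfl⟩, rfl⟩
    simp only [inner_add_left]
    exact add_le_add (inner_le_supportFn hA hs u) (inner_le_supportFn hB ht u)

theorem supportFn_smul (hA : IsCompact A) (hA₀ : A.Nonempty) {c : ℝ} (hc : 0 ≤ c)
    (u : RSpace n) : supportFn (c • A) u = c * supportFn A u := by
  obtain ⟨x, hx, hxu⟩ := exists_inner_eq_supportFn hA hA₀ u
  refine supportFn_eq_of_isGreatest ⟨⟨c • x, Set.smul_mem_smul_set hx, ?_⟩, ?_⟩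
  · simp only [real_inner_smul_left, hxu]
  · rintro _ ⟨_, ⟨s, hs, rfl⟩, rfl⟩
    simp only [real_inner_smul_left]
    exact mul_le_mul_of_nonneg_left (inner_le_supportFn hA hs u) hc

theorem supportFn_singleton (x u : RSpace n) : supportFn {x} u = inner ℝ x u :=
  supportFn_eq_of_isGreatest (by simp)

theorem supportFn_finsetSum {ι : Type*} {A : ι → Set (RSpace n)} {s : Finset ι}
    (hA : ∀ i ∈ s, IsCompact (A i)) (hA₀ : ∀ i ∈ s, (A i).Nonempty) (u : RSpace n) :
    supportFn (∑ i ∈ s, A i) u = ∑ i ∈ s, supportFn (A i) u := by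
  classical
  induction s using Finset.induction_on with
  | empty =>
    rw [Finset.sum_empty, Finset.sum_empty, ← Set.singleton_zero, supportFn_singleton,
      inner_zero_left]
  | insert i s his ih =>
    rw [Finset.forall_mem_insert] at hA hA₀
    rw [Finset.sum_insert his, Finset.sum_insert his, supportFn_add hA.1 hA₀.1
      (isCompact_finsetSum hA.2) (nonempty_finsetSum hA₀.2), ih hA.2 hA₀.2]

theorem supportFn_closedBall_zero {r : ℝ} (hr : 0 ≤ r) (u : RSpace n) :
    supportFn (Metric.closedBall 0 r) u = r * ‖u‖ := by
  refine supportFn_eq_of_isGreatest ⟨?_, ?_⟩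
  · rcases eq_or_ne u 0 with rfl | hu
    · exact ⟨0, by simpa using hr, by simp⟩
    · have hu' : ‖u‖ ≠ 0 := norm_ne_zero_iff.2 hu
      refine ⟨(r / ‖u‖) • u, ?_, ?_⟩
      · rw [mem_closedBall_zero_iff, norm_smul, Real.norm_of_nonneg (by positivity),
          div_mul_cancel₀ _ hu']
      · simp only [real_inner_smul_left, real_inner_self_eq_norm_sq]
        field_simp
  · rintro _ ⟨x, hx, rfl⟩
    rw [mem_closedBall_zero_iff] at hx
    exact (real_inner_le_norm x u).trans (by gcongr)

theorem supportFn_le_supportFn (hA : IsCompact A) (hA₀ : A.Nonempty) (hB : IsCompact B)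
    (h : A ⊆ B) (u : RSpace n) : supportFn A u ≤ supportFn B u :=
  (supportFn_le_iff hA hA₀).2 fun _ hx => inner_le_supportFn hB (h hx) u

/-- For each `x ∈ F` the values `⟪x, u⟫` and `⟪x, v⟫` differ by at most `R * ‖u - v‖`. The constant
depends only on `R`, so uniformly bounded sets have equicontinuous support functions. -/
theorem supportFn_sub_le (hF : IsCompact F) (hF₀ : F.Nonempty) {R : ℝ} (hR : ∀ x ∈ F, ‖x‖ ≤ R)
    (u v : RSpace n) : supportFn F u - supportFn F v ≤ R * ‖u - v‖ := by
  rw [sub_le_iff_le_add, supportFn_le_iff hF hF₀]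
  intro x hx
  have h1 : inner ℝ x u = inner ℝ x (u - v) + inner ℝ x v := by rw [← inner_add_right, sub_add_cancel]
  have h2 : inner ℝ x (u - v) ≤ R * ‖u - v‖ :=
    (real_inner_le_norm _ _).trans (by gcongr; exact hR x hx)
  linarith [inner_le_supportFn hF hx v]

theorem abs_supportFn_sub_le (hF : IsCompact F) (hF₀ : F.Nonempty) {R : ℝ} (hR : ∀ x ∈ F, ‖x‖ ≤ R)
    (u v : RSpace n) : |supportFn F u - supportFn F v| ≤ R * ‖u - v‖ :=
  abs_sub_le_iff.2 ⟨supportFn_sub_le hF hF₀ hR u v, norm_sub_rev u v ▸ supportFn_sub_le hF hF₀ hR v u⟩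

theorem supportFn_zero_right (hF₀ : F.Nonempty) : supportFn F 0 = 0 :=
  supportFn_eq_of_isGreatest (by simp [hF₀.image_const])

theorem abs_supportFn_le (hF : IsCompact F) (hF₀ : F.Nonempty) {R : ℝ} (hR : ∀ x ∈ F, ‖x‖ ≤ R)
    (u : RSpace n) : |supportFn F u| ≤ R * ‖u‖ := by
  simpa [supportFn_zero_right hF₀] using abs_supportFn_sub_le hF hF₀ hR u 0

theorem supportFn_smul_right (hF : IsCompact F) (hF₀ : F.Nonempty) {c : ℝ} (hc : 0 ≤ c)
    (u : RSpace n) : supportFn F (c • u) = c * supportFn F u := by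
  rw [← supportFn_smul hF hF₀ hc]
  simp only [supportFn, ← Set.image_smul, iSup_image, real_inner_smul_left, real_inner_smul_right]

theorem continuous_supportFn (hF : IsCompact F) (hF₀ : F.Nonempty) : Continuous (supportFn F) := by
  obtain ⟨R, hR⟩ := hF.isBounded.exists_norm_le
  refine LipschitzWith.continuous (K := R.toNNReal) (LipschitzWith.of_dist_le_mul fun u v => ?_)
  rw [dist_eq_norm, dist_eq_norm, Real.norm_eq_abs]
  exact abs_supportFn_sub_le hF hF₀ (fun x hx => (hR x hx).trans (Real.le_coe_toNNReal R)) u v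

/-- A point outside a closed convex set is strictly separated from it by a vector. -/
theorem exists_inner_lt_of_notMem (hF : IsClosed F) (hFc : Convex ℝ F) (hx : x ∉ F) :
    ∃ (u : RSpace n) (c : ℝ), (∀ y ∈ F, inner ℝ y u < c) ∧ c < inner ℝ x u := by
  obtain ⟨f, c, h1, h2⟩ := geometric_hahn_banach_closed_point hFc hF hx
  refine ⟨(InnerProductSpace.toDual ℝ (RSpace n)).symm f, c, fun y hy => ?_, ?_⟩
  · rw [real_inner_comm, InnerProductSpace.toDual_symm_apply]
    exact h1 y hy
  · rw [real_inner_comm, InnerProductSpace.toDual_symm_apply]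
    exact h2

/-- Hahn–Banach separation: a point outside `F` violates the inequality in the separating direction.
-/
theorem mem_iff_forall_inner_le_supportFn (hF : IsCompact F) (hFc : Convex ℝ F) (hF₀ : F.Nonempty) :
    x ∈ F ↔ ∀ u, inner ℝ x u ≤ supportFn F u := by
  refine ⟨fun hx u => inner_le_supportFn hF hx u, fun h => ?_⟩
  by_contra hx
  obtain ⟨u, c, h1, h2⟩ := exists_inner_lt_of_notMem hF.isClosed hFc hx
  have := (supportFn_le_iff hF hF₀).2 fun y hy => (h1 y hy).le
  linarith [h u]

theorem subset_of_supportFn_le (hA : IsCompact A) (hB : IsCompact B)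
    (hBc : Convex ℝ B) (hB₀ : B.Nonempty) (h : ∀ u, supportFn A u ≤ supportFn B u) : A ⊆ B :=
  fun _ hx => (mem_iff_forall_inner_le_supportFn hB hBc hB₀).2 fun u =>
    (inner_le_supportFn hA hx u).trans (h u)

/-- The intersection of the half-spaces `{x | ⟪x, d k⟫ ≤ h k}`. -/
def halfspaceInter (d : ℕ → RSpace n) (h : ℕ → ℝ) : Set (RSpace n) :=
  {x | ∀ k, inner ℝ x (d k) ≤ h k}

/-- A convex body is determined by the values of its support function on a dense sequence. -/
theorem halfspaceInter_supportFn (hF : IsCompact F) (hFc : Convex ℝ F) (hF₀ : F.Nonempty)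
    {d : ℕ → RSpace n} (hd : DenseRange d) :
    halfspaceInter d (fun k => supportFn F (d k)) = F := by
  ext x
  rw [mem_iff_forall_inner_le_supportFn hF hFc hF₀]
  refine ⟨fun h u => ?_, fun h k => h _⟩
  have hcl : IsClosed {u | inner ℝ x u ≤ supportFn F u} :=
    isClosed_le (by fun_prop) (continuous_supportFn hF hF₀)
  exact hd.induction_on (p := fun u => inner ℝ x u ≤ supportFn F u) u hcl h

/-- Membership of `x` in the intersection is jointly measurable in `(h, x)`, so volumes of sections
are measurable in `h`. This avoids any measurability of Minkowski addition on closed sets. -/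
theorem measurable_volumeRadius_halfspaceInter (d : ℕ → RSpace n) :
    Measurable fun h => volumeRadius (halfspaceInter d h) := by
  have hm : MeasurableSet {p : (ℕ → ℝ) × RSpace n | p.2 ∈ halfspaceInter d p.1} := by
    have : {p : (ℕ → ℝ) × RSpace n | p.2 ∈ halfspaceInter d p.1} =
        ⋂ k, {p : (ℕ → ℝ) × RSpace n | inner ℝ p.2 (d k) ≤ p.1 k} := by
      ext p
      simp [halfspaceInter]
    rw [this]
    refine MeasurableSet.iInter fun k => measurableSet_le ?_ ?_
    · exact (by fun_prop : Continuous fun x : RSpace n => (inner ℝ x (d k) : ℝ)).measurable.comp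
        measurable_snd
    · exact (measurable_pi_apply k).comp measurable_fst
  exact ((measurable_measure_prodMk_left (ν := (volume : Measure (RSpace n))) hm).ennreal_toReal).pow_const _

end SupportFn

/-! ### Measurability for the hit-or-miss topology. -/

namespace ClosedSets

variable {X : Type*} [TopologicalSpace X]

theorem measurableSet_hits_of_isOpen {G : Set X} (hG : IsOpen G) :
    MeasurableSet {F : ClosedSets X | (F.toSet ∩ G).Nonempty} := by
  have : IsOpen (missHit ∅ {G} : Set (ClosedSets X)) := TopologicalSpace.isOpen_generateFrom_of_mem
    ⟨∅, {G}, isCompact_empty, Set.finite_singleton G, by simpa using hG, rfl⟩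
  simpa [missHit] using this.measurableSet

theorem measurableSet_hits_of_isCompact {C : Set X} (hC : IsCompact C) :
    MeasurableSet {F : ClosedSets X | (F.toSet ∩ C).Nonempty} := by
  have : IsOpen (missHit C ∅ : Set (ClosedSets X)) := TopologicalSpace.isOpen_generateFrom_of_mem
    ⟨C, ∅, hC, Set.finite_empty, by simp, rfl⟩
  convert this.measurableSet.compl using 1
  ext F
  simp [missHit, Set.nonempty_iff_ne_empty]

/-- The supremum exceeds `c` exactly when `F` hits the open set `{f > c}`. -/
theorem measurable_iSup_mem {β : Type*} [CompleteLinearOrder β] [TopologicalSpace β]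
    [OrderTopology β] [SecondCountableTopology β] [MeasurableSpace β] [BorelSpace β] {f : X → β}
    (hf : Continuous f) : Measurable fun F : ClosedSets X => ⨆ x ∈ F.toSet, f x := by
  refine measurable_of_Ioi fun c => ?_
  convert measurableSet_hits_of_isOpen (isOpen_Ioi.preimage hf : IsOpen (f ⁻¹' Set.Ioi c)) using 1
  ext F
  simp [lt_iSup_iff, Set.Nonempty]

/-- Taking the supremum in `EReal` makes this hold on all closed sets, unbounded and empty ones
included. -/
theorem measurable_supportFn {n : ℕ} (u : RSpace n) :
    Measurable fun F : ClosedSets (RSpace n) => supportFn F.toSet u :=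
  (measurable_iSup_mem (continuous_coe_real_ereal.comp
    (by fun_prop : Continuous fun x : RSpace n => (inner ℝ x u : ℝ)))).ereal_toReal

theorem measurable_setNorm {n : ℕ} :
    Measurable fun F : ClosedSets (RSpace n) => setNorm F.toSet :=
  measurable_iSup_mem continuous_enorm

end ClosedSets

/-! ### Continuity of the volume radius -/

section Continuity

variable {n : ℕ} {A : ℕ → Set (RSpace n)} {B : Set (RSpace n)}

/-- If the support functions of bounded compact sets converge on a dense set, then they converge
uniformly on the unit ball. -/
theorem eventually_abs_supportFn_sub_le {d : ℕ → RSpace n} (hd : DenseRange d)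
    (hA : ∀ i, IsCompact (A i)) (hA₀ : ∀ i, (A i).Nonempty)
    (hB : IsCompact B) (hB₀ : B.Nonempty) {R : ℝ} (hR : ∀ i, ∀ x ∈ A i, ‖x‖ ≤ R)
    (hlim : ∀ k, Tendsto (fun i => supportFn (A i) (d k)) atTop (𝓝 (supportFn B (d k))))
    {ε : ℝ} (hε : 0 < ε) :
    ∀ᶠ i in atTop, ∀ u, |supportFn (A i) u - supportFn B u| ≤ ε * ‖u‖ := by
  obtain ⟨R', hR'⟩ := hB.isBounded.exists_norm_le
  set S := max (max R R') 0 with hS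
  have hSA : ∀ i, ∀ x ∈ A i, ‖x‖ ≤ S := fun i x hx => (hR i x hx).trans (by simp [hS])
  have hSB : ∀ x ∈ B, ‖x‖ ≤ S := fun x hx => (hR' x hx).trans (by simp [hS])
  have hS0 : 0 ≤ S := le_max_right _ _
  -- Each of the two changes of direction costs `ε / 4` and the finite net costs `ε / 2`; the `+ 1`
  -- keeps the denominator positive.
  set δ := ε / (4 * (S + 1)) with hδ
  have hδ0 : 0 < δ := by positivity
  have hSδ : S * δ ≤ ε / 4 := by
    rw [hδ]
    rw [mul_div_assoc', div_le_div_iff₀ (by positivity) (by positivity)]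
    nlinarith
  obtain ⟨t, ht⟩ := (isCompact_closedBall (0 : RSpace n) 1).elim_finite_subcover
    (fun k => Metric.ball (d k) δ) (fun k => Metric.isOpen_ball) (fun u _ => by
      obtain ⟨k, hk⟩ := hd.exists_dist_lt u hδ0
      exact Set.mem_iUnion.2 ⟨k, hk⟩)
  have hev : ∀ᶠ i in atTop, ∀ k ∈ t, |supportFn (A i) (d k) - supportFn B (d k)| ≤ ε / 2 := by
    rw [Filter.eventually_all_finset]
    intro k _
    filter_upwards [(Metric.tendsto_nhds.1 (hlim k)) (ε / 2) (by positivity)] with i hi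
    exact (Real.dist_eq _ _ ▸ hi).le
  filter_upwards [hev] with i hi
  have hunit : ∀ u : RSpace n, ‖u‖ ≤ 1 → |supportFn (A i) u - supportFn B u| ≤ ε := by
    intro u hu
    obtain ⟨k, hk, huk⟩ := Set.mem_iUnion₂.1 (ht (mem_closedBall_zero_iff.2 hu))
    rw [Metric.mem_ball, dist_eq_norm] at huk
    have h1 := abs_supportFn_sub_le (hA i) (hA₀ i) (hSA i) u (d k)
    have h2 := abs_supportFn_sub_le hB hB₀ hSB u (d k)
    have h3 : S * ‖u - d k‖ ≤ ε / 4 := (mul_le_mul_of_nonneg_left huk.le hS0).trans hSδ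
    have h4 := hi k hk
    rw [abs_le] at h1 h2 h4 ⊢
    constructor <;> linarith
  intro u
  rcases eq_or_ne u 0 with rfl | hu
  · simp [supportFn_zero_right (hA₀ i), supportFn_zero_right hB₀]
  have hu' : 0 < ‖u‖ := norm_pos_iff.2 hu
  have := hunit (‖u‖⁻¹ • u) (by rw [norm_smul, norm_inv, norm_norm, inv_mul_cancel₀ hu'.ne'])
  rw [supportFn_smul_right (hA i) (hA₀ i) (by positivity), supportFn_smul_right hB hB₀ (by positivity),
    ← mul_sub, abs_mul, abs_of_pos (inv_pos.2 hu'), inv_mul_le_iff₀ hu'] at this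
  linarith

theorem tendsto_volumeRadius_cthickening (hB : IsCompact B) :
    Tendsto (fun ε => volumeRadius (Metric.cthickening ε B)) (𝓝 0) (𝓝 (volumeRadius B)) :=
  ((ENNReal.tendsto_toReal hB.measure_ne_top).comp
    (tendsto_measure_cthickening_of_isCompact hB)).rpow_const (Or.inr (by positivity))

/-- The right-hand side is the support function of `B + closedBall 0 ε`, which is the closed
thickening. -/
theorem subset_cthickening_of_supportFn_le {A : Set (RSpace n)} (hA : IsCompact A)
    (hB : IsCompact B) (hB₀ : B.Nonempty) (hBc : Convex ℝ B) {ε : ℝ} (hε : 0 ≤ ε)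
    (h : ∀ u, supportFn A u ≤ supportFn B u + ε * ‖u‖) : A ⊆ Metric.cthickening ε B := by
  have hball := isCompact_closedBall (0 : RSpace n) ε
  have hball₀ : (Metric.closedBall (0 : RSpace n) ε).Nonempty := ⟨0, by simpa using hε⟩
  rw [← hB.add_closedBall_zero hε]
  refine subset_of_supportFn_le hA (hB.add hball) (hBc.add (convex_closedBall _ _))
    (hB₀.add hball₀) fun u => ?_
  rw [supportFn_add hB hB₀ hball hball₀, supportFn_closedBall_zero hε]
  exact h u

/-- Shrinking `B` towards `c` by the factor `1 - θ` lowers its support function by at least `θ * r *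
‖u‖`, because `B` contains the ball; this absorbs the error term. -/
theorem add_smul_subset_of_supportFn_le {A : Set (RSpace n)} (hA : IsCompact A) (hA₀ : A.Nonempty)
    (hAc : Convex ℝ A) (hB : IsCompact B) {c : RSpace n} {r θ : ℝ} (hr : 0 ≤ r)
    (hc : Metric.closedBall c r ⊆ B) (hθ : 0 ≤ θ) (hθ₁ : θ ≤ 1)
    (h : ∀ u, supportFn B u ≤ supportFn A u + θ * r * ‖u‖) :
    {θ • c} + (1 - θ) • B ⊆ A := by
  have hB₀ : B.Nonempty := ⟨c, hc (by simpa using hr)⟩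
  have hBs : IsCompact ((1 - θ) • B) := hB.smul _
  refine subset_of_supportFn_le (isCompact_singleton.add hBs) hA hAc hA₀ fun u => ?_
  rw [supportFn_add isCompact_singleton (Set.singleton_nonempty _) hBs hB₀.smul_set,
    supportFn_singleton, supportFn_smul hB hB₀ (by linarith), real_inner_smul_left]
  have hball : supportFn (Metric.closedBall c r) u = inner ℝ c u + r * ‖u‖ := by
    rw [← singleton_add_closedBall_zero, supportFn_add isCompact_singleton
      (Set.singleton_nonempty _) (isCompact_closedBall _ _) ⟨0, by simpa using hr⟩,
      supportFn_singleton, supportFn_closedBall_zero hr]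
  have h2 := supportFn_le_supportFn (isCompact_closedBall c r) ⟨c, by simpa using hr⟩ hB hc u
  rw [hball] at h2
  nlinarith [h u, mul_le_mul_of_nonneg_left h2 hθ]

/-- The boundary of a convex set is a null set. -/
theorem interior_nonempty_of_volumeRadius_pos (hn : n ≠ 0) (hB : IsCompact B) (hBc : Convex ℝ B)
    (h : 0 < volumeRadius B) : (interior B).Nonempty := by
  by_contra hi
  rw [Set.not_nonempty_iff_eq_empty] at hi
  have h0 : volume B = 0 := by
    have := hBc.addHaar_frontier (volume : Measure (RSpace n))
    rwa [frontier, hi, Set.sdiff_empty, hB.isClosed.closure_eq] at this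
  have := volumeRadius_pow hn B
  rw [measureReal_def, h0, ENNReal.toReal_zero] at this
  exact (pow_pos h n).ne' this

/-- The volume radius is continuous on convex bodies, with respect to pointwise convergence of
support functions on a dense set. -/
theorem tendsto_volumeRadius_of_tendsto_supportFn (hn : n ≠ 0) {d : ℕ → RSpace n}
    (hd : DenseRange d) (hA : ∀ i, IsCompact (A i)) (hA₀ : ∀ i, (A i).Nonempty)
    (hAc : ∀ i, Convex ℝ (A i)) (hB : IsCompact B) (hB₀ : B.Nonempty) (hBc : Convex ℝ B) {R : ℝ}
    (hR : ∀ i, ∀ x ∈ A i, ‖x‖ ≤ R)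
    (hlim : ∀ k, Tendsto (fun i => supportFn (A i) (d k)) atTop (𝓝 (supportFn B (d k)))) :
    Tendsto (fun i => volumeRadius (A i)) atTop (𝓝 (volumeRadius B)) := by
  have hunif := fun {ε : ℝ} (hε : 0 < ε) =>
    eventually_abs_supportFn_sub_le hd hA hA₀ hB hB₀ hR hlim hε
  refine tendsto_order.2 ⟨fun c hc => ?_, fun c hc => ?_⟩
  · rcases lt_or_ge c 0 with h0 | h0
    · exact Eventually.of_forall fun i => h0.trans_le (volumeRadius_nonneg _)
    have hpos : 0 < volumeRadius B := h0.trans_lt hc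
    obtain ⟨x, hx⟩ := interior_nonempty_of_volumeRadius_pos hn hB hBc hpos
    obtain ⟨r, hr, hball⟩ := Metric.nhds_basis_closedBall.mem_iff.1 (mem_interior_iff_mem_nhds.1 hx)
    -- Chosen so that `(1 - θ) * volumeRadius B` is the midpoint of `c` and `volumeRadius B`.
    set θ := (volumeRadius B - c) / (2 * volumeRadius B) with hθdef
    have hθ : 0 < θ := div_pos (by linarith) (by linarith)
    have hθ₁ : θ ≤ 1 := (div_le_one (by linarith)).2 (by linarith)
    have hθB : (1 - θ) * volumeRadius B = (volumeRadius B + c) / 2 := by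
      rw [hθdef]; field_simp; ring
    filter_upwards [hunif (mul_pos hθ hr)] with i hi
    have hsub := add_smul_subset_of_supportFn_le (hA i) (hA₀ i) (hAc i) hB hr.le hball hθ.le hθ₁
      fun u => by linarith [(abs_le.1 (hi u)).1]
    have := volumeRadius_mono hsub (hA i).measure_ne_top
    rw [volumeRadius_vadd, volumeRadius_smul hn (by linarith), hθB] at this
    linarith
  -- For the upper bound, `A i` eventually lies in a thickening of `B` whose volume radius is below
  -- `c`.
  · have hev := (tendsto_volumeRadius_cthickening hB).eventually (gt_mem_nhds hc)
    obtain ⟨ε, hεc, hε⟩ := ((hev.filter_mono nhdsWithin_le_nhds).and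
      (self_mem_nhdsWithin : Set.Ioi (0 : ℝ) ∈ 𝓝[>] 0)).exists
    filter_upwards [hunif hε] with i hi
    exact (volumeRadius_mono (subset_cthickening_of_supportFn_le (hA i) hB hB₀ hBc (le_of_lt hε)
      fun u => by linarith [(abs_le.1 (hi u)).2]) hB.cthickening.measure_ne_top).trans_lt hεc

end Continuity

/-! ### Measurable selections and the Aumann expectation -/

/-! ### Nearest points in compact convex sets. -/

section NearestPoint

variable {n : ℕ} {F : Set (RSpace n)}

/-- The Euclidean norm is strictly convex: the midpoint of two nearest points would be nearer. -/
theorem Convex.nearestPoint_unique (hFc : Convex ℝ F) {p q y : RSpace n} (hp : p ∈ F) (hq : q ∈ F)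
    (hpy : ∀ x ∈ F, dist p y ≤ dist x y) (hqy : ∀ x ∈ F, dist q y ≤ dist x y) : p = q := by
  by_contra hne
  have hpq : ‖p - y‖ = ‖q - y‖ := by
    rw [← dist_eq_norm, ← dist_eq_norm]
    exact le_antisymm (hpy q hq) (hqy p hp)
  have hmid : (1 / 2 : ℝ) • p + (1 / 2 : ℝ) • q ∈ F :=
    hFc hp hq (by norm_num) (by norm_num) (by norm_num)
  have h1 := (norm_midpoint_lt_iff hpq).2 (fun h => hne (sub_left_injective h))
  have h2 := hpy _ hmid
  rw [dist_eq_norm, dist_eq_norm] at h2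
  have h3 : (1 / 2 : ℝ) • p + (1 / 2 : ℝ) • q - y = (1 / 2 : ℝ) • (p - y + (q - y)) := by module
  rw [h3] at h2
  exact h2.not_gt h1

/-- Membership of the nearest point in a closed set, expressed by countably many hitting
conditions. -/
theorem nearestPoint_mem_iff (hF : IsCompact F) (hFc : Convex ℝ F) {p y : RSpace n} (hp : p ∈ F)
    (hpy : ∀ x ∈ F, dist p y ≤ dist x y) {C : Set (RSpace n)} (hC : IsClosed C) :
    p ∈ C ↔ ∀ q : ℚ, (F ∩ Metric.closedBall y q).Nonempty →
      (F ∩ (C ∩ Metric.closedBall y q)).Nonempty := by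
  constructor
  · rintro hpC q ⟨x, hx, hxq⟩
    exact ⟨p, hp, hpC, (hpy x hx).trans hxq⟩
  · intro h
    have hFC : (F ∩ C).Nonempty := by
      obtain ⟨q, hq⟩ := exists_rat_gt (dist p y)
      obtain ⟨x, hx, hxC, -⟩ := h q ⟨p, hp, hq.le⟩
      exact ⟨x, hx, hxC⟩
    -- Rational radii decreasing to `dist p y` show that the point `z` of `F ∩ C` nearest to `y` is
    -- nearest in all of `F`, so `z = p` by uniqueness.
    obtain ⟨z, ⟨hzF, hzC⟩, hz⟩ := (hF.inter_right hC).exists_isMinOn hFC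
      (f := fun x => dist x y) (by fun_prop)
    have hzp : dist z y ≤ dist p y := by
      refine le_of_forall_gt_imp_ge_of_dense fun c hc => ?_
      obtain ⟨q, hq, hqc⟩ := exists_rat_btwn hc
      obtain ⟨x, hx, hxC, hxq⟩ := h q ⟨p, hp, hq.le⟩
      exact ((hz ⟨hx, hxC⟩ : dist z y ≤ dist x y).trans hxq).trans hqc.le
    rw [Convex.nearestPoint_unique hFc hp hzF hpy fun x hx => hzp.trans (hpy x hx)]
    exact hzC

/-- A point of a compact set that is nearest to a remote point `t • u` almost maximizes
`⟪·, u⟫`. -/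
theorem supportFn_sub_inner_le (hF : IsCompact F) {p u : RSpace n} {t R : ℝ}
    (hp : p ∈ F) (hpt : ∀ x ∈ F, dist p (t • u) ≤ dist x (t • u)) (hR : ∀ x ∈ F, ‖x‖ ≤ R)
    (ht : 0 < t) : supportFn F u - R ^ 2 / (2 * t) ≤ inner ℝ p u := by
  obtain ⟨x, hx, hxu⟩ := exists_inner_eq_supportFn hF ⟨p, hp⟩ u
  have h := hpt x hx
  rw [dist_eq_norm, dist_eq_norm] at h
  -- Expanding the squared distances gives `2 * t * (⟪x, u⟫ - ⟪p, u⟫) ≤ ‖x‖ ^ 2 - ‖p‖ ^ 2 ≤ R ^ 2`.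
  have h2 := pow_le_pow_left₀ (norm_nonneg _) h 2
  rw [norm_sub_sq_real, norm_sub_sq_real, real_inner_smul_right, real_inner_smul_right, hxu] at h2
  have h3 := pow_le_pow_left₀ (norm_nonneg _) (hR x hx) 2
  have h4 : supportFn F u - inner ℝ p u ≤ R ^ 2 / (2 * t) := by
    rw [le_div_iff₀ (by positivity)]
    nlinarith [sq_nonneg ‖p‖]
  linarith

/-- Compactness excludes the value `∞`, which `toReal` would send to `0`. -/
theorem norm_le_toReal_setNorm (hF : IsCompact F) {x : RSpace n} (hx : x ∈ F) :
    ‖x‖ ≤ (setNorm F).toReal := by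
  obtain ⟨R, hR⟩ := hF.isBounded.exists_norm_le
  have hfin : setNorm F ≠ ∞ := by
    refine ne_top_of_le_ne_top (ENNReal.ofReal_ne_top (r := R)) (iSup₂_le fun y hy => ?_)
    rw [← ofReal_norm]
    exact ENNReal.ofReal_le_ofReal (hR y hy)
  rw [← toReal_enorm]
  exact ENNReal.toReal_mono hfin (le_iSup₂ (f := fun (y : RSpace n) (_ : y ∈ F) => ‖y‖ₑ) x hx)

end NearestPoint

/-! ### Selectors and the Aumann expectation. -/

section Aumann

variable {n : ℕ} {Ω : Type*} [MeasurableSpace Ω] {P : Measure Ω}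
  {K : Ω → ClosedSets (RSpace n)}

/-- The nearest point to a given point is a selector. -/
theorem IsRandomCompactConvex.exists_isSelector_nearest (hK : IsRandomCompactConvex P K)
    (y : RSpace n) :
    ∃ ξ : Ω → RSpace n, IsSelector P K ξ ∧
      ∀ᵐ ω ∂P, ∀ x ∈ (K ω).toSet, dist (ξ ω) y ≤ dist x y := by
  classical
  have hgood := hK.ae_nonempty.and (hK.ae_isCompact.and hK.ae_convex)
  -- The exceptional set is enlarged to a measurable null set, on which the selector is set to `0`,
  -- so that it is measurable everywhere.
  obtain ⟨N, hN, hNm, hN0⟩ := exists_measurable_superset_of_null (ae_iff.1 hgood)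
  have hgN : ∀ ω, ω ∉ N → (K ω).toSet.Nonempty ∧ IsCompact (K ω).toSet ∧ Convex ℝ (K ω).toSet :=
    fun ω hω => by
      by_contra h
      exact hω (hN h)
  have hex : ∀ ω, ∃ p : RSpace n, (ω ∈ N → p = 0) ∧
      (ω ∉ N → p ∈ (K ω).toSet ∧ ∀ x ∈ (K ω).toSet, dist p y ≤ dist x y) := by
    intro ω
    by_cases hω : ω ∈ N
    · exact ⟨0, fun _ => rfl, fun h => absurd hω h⟩
    · obtain ⟨p, hp, hpy⟩ := (hgN ω hω).2.1.exists_isMinOn (hgN ω hω).1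
        (f := fun x => dist x y) (by fun_prop)
      exact ⟨p, fun h => absurd h hω, fun _ => ⟨hp, fun x hx => hpy hx⟩⟩
  choose ξ hξN hξ using hex
  have hNae : ∀ᵐ ω ∂P, ω ∉ N := measure_eq_zero_iff_ae_notMem.1 hN0
  refine ⟨ξ, ⟨measurable_of_isClosed fun C hC => ?_, ?_⟩, ?_⟩
  · have hset : ξ ⁻¹' C = (N ∩ {_ω | (0 : RSpace n) ∈ C}) ∪ (Nᶜ ∩ ⋂ q : ℚ,
        (K ⁻¹' {F | (F.toSet ∩ Metric.closedBall y q).Nonempty})ᶜ ∪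
          K ⁻¹' {F | (F.toSet ∩ (C ∩ Metric.closedBall y q)).Nonempty}) := by
      ext ω
      by_cases hω : ω ∈ N
      · simp [hω, hξN ω hω]
      · have := nearestPoint_mem_iff (hgN ω hω).2.1 (hgN ω hω).2.2 (hξ ω hω).1 (hξ ω hω).2 hC
        simp only [Set.mem_preimage, this, hω, imp_iff_not_or, Set.mem_union, Set.mem_inter_iff,
          false_and, Set.mem_compl_iff, not_false_eq_true, true_and, false_or, Set.mem_iInter]
        rfl
    rw [hset]
    refine (hNm.inter (MeasurableSet.const _)).union (hNm.compl.inter (MeasurableSet.iInter fun q =>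
      MeasurableSet.union (hK.measurable ?_).compl (hK.measurable ?_)))
    · exact ClosedSets.measurableSet_hits_of_isCompact (isCompact_closedBall _ _)
    · exact ClosedSets.measurableSet_hits_of_isCompact ((isCompact_closedBall _ _).inter_left hC)
  · filter_upwards [hNae] with ω hω using (hξ ω hω).1
  · filter_upwards [hNae] with ω hω using (hξ ω hω).2

theorem IsRandomCompactConvex.integrable_toReal_setNorm (hK : IsRandomCompactConvex P K)
    (hnorm : ∫⁻ ω, setNorm (K ω).toSet ∂P < ∞) :
    Integrable (fun ω => (setNorm (K ω).toSet).toReal) P :=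
  integrable_toReal_of_lintegral_ne_top
    (ClosedSets.measurable_setNorm.comp hK.measurable).aemeasurable hnorm.ne

theorem IsRandomCompactConvex.integrable_supportFn (hK : IsRandomCompactConvex P K)
    (hnorm : ∫⁻ ω, setNorm (K ω).toSet ∂P < ∞) (u : RSpace n) :
    Integrable (fun ω => supportFn (K ω).toSet u) P := by
  refine ((hK.integrable_toReal_setNorm hnorm).mul_const ‖u‖).mono'
    ((ClosedSets.measurable_supportFn u).comp hK.measurable).aestronglyMeasurable ?_
  filter_upwards [hK.ae_nonempty, hK.ae_isCompact] with ω h0 hc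
  exact abs_supportFn_le hc h0 (fun x hx => norm_le_toReal_setNorm hc hx) u

theorem IsSelector.ae_norm_le (hK : IsRandomCompactConvex P K) {ξ : Ω → RSpace n}
    (hξ : IsSelector P K ξ) : ∀ᵐ ω ∂P, ‖ξ ω‖ ≤ (setNorm (K ω).toSet).toReal := by
  filter_upwards [hK.ae_isCompact, hξ.ae_mem] with ω hc hx using norm_le_toReal_setNorm hc hx

theorem IsSelector.integrable (hK : IsRandomCompactConvex P K) {ξ : Ω → RSpace n}
    (hξ : IsSelector P K ξ) (hnorm : ∫⁻ ω, setNorm (K ω).toSet ∂P < ∞) : Integrable ξ P :=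
  (hK.integrable_toReal_setNorm hnorm).mono' hξ.measurable.aestronglyMeasurable (hξ.ae_norm_le hK)

theorem IsRandomCompactConvex.norm_le_of_mem_aumannExpectation (hK : IsRandomCompactConvex P K)
    (hnorm : ∫⁻ ω, setNorm (K ω).toSet ∂P < ∞) {x : RSpace n} (hx : x ∈ aumannExpectation P K) :
    ‖x‖ ≤ ∫ ω, (setNorm (K ω).toSet).toReal ∂P := by
  obtain ⟨ξ, hξ, hint, rfl⟩ := hx
  exact norm_integral_le_of_norm_le (hK.integrable_toReal_setNorm hnorm) (hξ.ae_norm_le hK)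

theorem IsRandomCompactConvex.isCompact_closure_aumannExpectation (hK : IsRandomCompactConvex P K)
    (hnorm : ∫⁻ ω, setNorm (K ω).toSet ∂P < ∞) : IsCompact (closure (aumannExpectation P K)) :=
  (isBounded_iff_forall_norm_le.2
    ⟨_, fun _ => hK.norm_le_of_mem_aumannExpectation hnorm⟩).isCompact_closure

theorem IsRandomCompactConvex.aumannExpectation_nonempty (hK : IsRandomCompactConvex P K)
    (hnorm : ∫⁻ ω, setNorm (K ω).toSet ∂P < ∞) : (aumannExpectation P K).Nonempty := by
  obtain ⟨ξ, hξ, -⟩ := hK.exists_isSelector_nearest 0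
  exact ⟨_, ξ, hξ, hξ.integrable hK hnorm, rfl⟩

theorem IsRandomCompactConvex.convex_aumannExpectation (hK : IsRandomCompactConvex P K) :
    Convex ℝ (aumannExpectation P K) := by
  rintro _ ⟨ξ, hξ, hξi, rfl⟩ _ ⟨η, hη, hηi, rfl⟩ a b ha hb hab
  refine ⟨fun ω => a • ξ ω + b • η ω, ⟨(hξ.measurable.const_smul a).add (hη.measurable.const_smul b),
    ?_⟩, (hξi.smul a).add (hηi.smul b), ?_⟩
  · filter_upwards [hK.ae_convex, hξ.ae_mem, hη.ae_mem] with ω hc h1 h2 using hc h1 h2 ha hb hab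
  · rw [← integral_smul, ← integral_smul]
    exact integral_add (hξi.smul a) (hηi.smul b)

/-- The support function of the Aumann expectation is the expectation of the support function. -/
theorem IsRandomCompactConvex.supportFn_closure_aumannExpectation (hK : IsRandomCompactConvex P K)
    (hnorm : ∫⁻ ω, setNorm (K ω).toSet ∂P < ∞) (u : RSpace n) :
    supportFn (closure (aumannExpectation P K)) u = ∫ ω, supportFn (K ω).toSet u ∂P := by
  have hcomp := hK.isCompact_closure_aumannExpectation hnorm
  have hne := (hK.aumannExpectation_nonempty hnorm).closure
  have hinner : ∀ {ξ : Ω → RSpace n}, Integrable ξ P →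
      inner ℝ (∫ ω, ξ ω ∂P) u = ∫ ω, inner ℝ (ξ ω) u ∂P := fun hξ => by
    rw [real_inner_comm, ← integral_inner hξ]
    simp only [real_inner_comm]
  refine le_antisymm ((supportFn_le_iff hcomp hne).2 fun x hx => ?_) ?_
  -- The half-space is closed, so it suffices to treat expectations of selectors.
  · refine closure_minimal (s := aumannExpectation P K)
      (t := {x | inner ℝ x u ≤ ∫ ω, supportFn (K ω).toSet u ∂P}) ?_
      (isClosed_le (by fun_prop) continuous_const) hx
    rintro _ ⟨ξ, hξ, hξi, rfl⟩
    change inner ℝ (∫ ω, ξ ω ∂P) u ≤ _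
    rw [hinner hξi]
    refine integral_mono_ae (hξi.inner_const u) (hK.integrable_supportFn hnorm u) ?_
    filter_upwards [hK.ae_isCompact, hξ.ae_mem] with ω hc h using inner_le_supportFn hc h u
  -- Selectors nearest to the remote points `(m + 1) • u` maximize `⟪·, u⟫` up to an error of order
  -- `1 / (m + 1)`; their expectations lie in the set, and dominated convergence applies.
  · choose ξ hξ hnear using fun m : ℕ => hK.exists_isSelector_nearest (((m : ℝ) + 1) • u)
    have hlim : Tendsto (fun m => ∫ ω, inner ℝ (ξ m ω) u ∂P) atTop
        (𝓝 (∫ ω, supportFn (K ω).toSet u ∂P)) := by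
      refine tendsto_integral_of_dominated_convergence
        (fun ω => (setNorm (K ω).toSet).toReal * ‖u‖)
        (fun m => (((hξ m).integrable hK hnorm).inner_const u).aestronglyMeasurable)
        ((hK.integrable_toReal_setNorm hnorm).mul_const _) (fun m => ?_) ?_
      · filter_upwards [(hξ m).ae_norm_le hK] with ω h
        exact (norm_inner_le_norm _ _).trans (by gcongr)
      · filter_upwards [hK.ae_isCompact, ae_all_iff.2 fun m => (hξ m).ae_mem, ae_all_iff.2 hnear]
          with ω hc hmem hn
        set R := (setNorm (K ω).toSet).toReal
        have h0 : Tendsto (fun m : ℕ => supportFn (K ω).toSet u - R ^ 2 / 2 * (1 / ((m : ℝ) + 1)))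
            atTop (𝓝 (supportFn (K ω).toSet u)) := by
          simpa using (tendsto_const_nhds (x := supportFn (K ω).toSet u)).sub
            ((tendsto_one_div_add_atTop_nhds_zero_nat (𝕜 := ℝ)).const_mul (R ^ 2 / 2))
        refine tendsto_of_tendsto_of_tendsto_of_le_of_le h0 tendsto_const_nhds (fun m => ?_)
          fun m => inner_le_supportFn hc (hmem m) u
        have := supportFn_sub_inner_le hc (hmem m) (hn m)
          (fun x hx => norm_le_toReal_setNorm hc hx) (by positivity)
        have heq : R ^ 2 / 2 * (1 / ((m : ℝ) + 1)) = R ^ 2 / (2 * ((m : ℝ) + 1)) := by field_simp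
        rwa [heq]
    refine le_of_tendsto' hlim fun m => ?_
    rw [← hinner ((hξ m).integrable hK hnorm)]
    exact inner_le_supportFn hcomp
      (subset_closure ⟨_, hξ m, (hξ m).integrable hK hnorm, rfl⟩) u

/-- Convexity makes the boundary null, so closedness of the Aumann expectation itself is never
needed. -/
theorem IsRandomCompactConvex.volume_closure_aumannExpectation (hK : IsRandomCompactConvex P K) :
    volume (closure (aumannExpectation P K)) = volume (aumannExpectation P K) :=
  measure_closure_of_null_frontier (hK.convex_aumannExpectation.addHaar_frontier _)

end Aumann

/-! ### Sums of independent and identically distributed random sets -/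

section Sums

variable {Ω : Type*} [MeasurableSpace Ω] {P : Measure Ω} [IsProbabilityMeasure P]

/-- The law of a finite sum of independent identically distributed variables depends only on the
number of the summands. -/
theorem map_finsetSum_eq_of_card_eq {ι E : Type*} [AddCommMonoid E] [MeasurableSpace E]
    [MeasurableAdd₂ E] {X : ι → Ω → E} (hm : ∀ i, Measurable (X i)) (hind : iIndepFun X P)
    (hid : ∀ i j, P.map (X i) = P.map (X j)) {s t : Finset ι} (h : s.card = t.card) :
    P.map (∑ i ∈ s, X i) = P.map (∑ i ∈ t, X i) := by
  classical
  rcases isEmpty_or_nonempty ι with hι | ⟨⟨o⟩⟩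
  · rw [Subsingleton.elim s t]
  -- By independence the law is an iterated convolution of the common law, taken as that of `X o`.
  have key : ∀ s : Finset ι, P.map (∑ i ∈ s, X i) =
      Nat.rec (P.map (0 : Ω → E)) (fun _ ν => ν ∗ P.map (X o)) s.card := by
    intro s
    induction s using Finset.induction_on with
    | empty => simp
    | insert i s his ih =>
      have hs : Measurable (∑ j ∈ s, X j) := by
        rw [Finset.sum_fn]
        exact Finset.measurable_sum _ fun j _ => hm j
      have := Measure.isProbabilityMeasure_map (μ := P) hs.aemeasurable
      have := Measure.isProbabilityMeasure_map (μ := P) (hm i).aemeasurable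
      rw [Finset.sum_insert his, add_comm, Finset.card_insert_of_notMem his,
        (hind.indepFun_finsetSum_of_notMem hm his).map_add_eq_map_conv_map₀' hs.aemeasurable
          (hm i).aemeasurable inferInstance inferInstance, ih, hid i o]
  rw [key, key, h]

/-- Convergence of integrals of functions that are dominated by a sequence which converges in `L¹`
to a constant. -/
theorem tendsto_integral_of_le_of_tendsto_integral_abs_sub {V S : ℕ → Ω → ℝ} {v σ : ℝ}
    (hV : ∀ i, Integrable (V i) P) (hS : ∀ i, Integrable (S i) P) (hV₀ : ∀ i, ∀ᵐ ω ∂P, 0 ≤ V i ω)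
    (hVS : ∀ i, ∀ᵐ ω ∂P, V i ω ≤ S i ω) (hvσ : v ≤ σ)
    (hlim : ∀ᵐ ω ∂P, Tendsto (fun i => V i ω) atTop (𝓝 v))
    (hSσ : Tendsto (fun i => ∫ ω, |S i ω - σ| ∂P) atTop (𝓝 0)) :
    Tendsto (fun i => ∫ ω, V i ω ∂P) atTop (𝓝 v) := by
  -- Truncated at `σ`, the sequence is bounded and dominated convergence applies; the excess over
  -- `σ` is at most `|S i - σ|`, which vanishes in `L¹`.
  have hW : ∀ i, Integrable (fun ω => min (V i ω) σ) P := fun i => (hV i).inf (integrable_const σ)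
  have h1 : Tendsto (fun i => ∫ ω, min (V i ω) σ ∂P) atTop (𝓝 v) := by
    have := tendsto_integral_of_dominated_convergence (μ := P) (F := fun i ω => min (V i ω) σ)
      (f := fun _ => v) (fun _ => |σ|) (fun i => (hW i).aestronglyMeasurable) (integrable_const _)
      (fun i => ?_) ?_
    · simpa using this
    · filter_upwards [hV₀ i] with ω h
      rw [Real.norm_eq_abs, abs_le]
      exact ⟨le_min (by linarith [abs_nonneg σ]) (neg_abs_le σ), (min_le_right _ _).trans (le_abs_self σ)⟩
    · filter_upwards [hlim] with ω h
      simpa [min_eq_left hvσ] using h.min (tendsto_const_nhds (x := σ))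
  have h2 : Tendsto (fun i => ∫ ω, (V i ω - min (V i ω) σ) ∂P) atTop (𝓝 0) := by
    refine squeeze_zero (fun i => integral_nonneg fun ω => sub_nonneg.2 (min_le_left _ _))
      (fun i => integral_mono_ae ((hV i).sub (hW i)) ((hS i).sub (integrable_const σ)).abs ?_) hSσ
    filter_upwards [hVS i] with ω h
    change V i ω - min (V i ω) σ ≤ |S i ω - σ|
    rcases le_total (V i ω) σ with h' | h'
    · simp [min_eq_left h']
    · rw [min_eq_right h']
      exact (sub_le_sub_right h σ).trans (le_abs_self _)
  simpa [integral_sub (hV _) (hW _)] using h1.add h2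

/-- The `L¹` form of the strong law of large numbers, for real random variables. -/
theorem tendsto_integral_abs_average_sub {X : ℕ → Ω → ℝ} (hint : Integrable (X 0) P)
    (hindep : Pairwise fun i j => X i ⟂ᵢ[P] X j) (hident : ∀ i, IdentDistrib (X i) (X 0) P P) :
    Tendsto (fun M : ℕ => ∫ ω, |(M : ℝ)⁻¹ * (∑ i ∈ Finset.range M, X i ω) - ∫ ω, X 0 ω ∂P| ∂P)
      atTop (𝓝 0) := by
  have h := strong_law_Lp le_rfl ENNReal.one_ne_top X (memLp_one_iff_integrable.2 hint) hindep hident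
  have h2 := (ENNReal.tendsto_toReal ENNReal.zero_ne_top).comp h
  refine (h2.congr fun M => ?_)
  have hi : Integrable (fun ω => (M : ℝ)⁻¹ * (∑ i ∈ Finset.range M, X i ω) - ∫ ω, X 0 ω ∂P) P :=
    ((integrable_finsetSum _ fun i _ => (hident i).integrable_iff.2 hint).const_mul _).sub
      (integrable_const _)
  rw [Function.comp_apply, eLpNorm_one_eq_lintegral_enorm]
  exact (integral_norm_eq_lintegral_enorm hi.aestronglyMeasurable).symm

end Sums

/-! ### Empirical means of random convex bodies. -/

section RandomSets

variable {n : ℕ} {Ω : Type*} [MeasurableSpace Ω] {P : Measure Ω}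
  {K : Ω → ClosedSets (RSpace n)} {Ks : ℕ → Ω → ClosedSets (RSpace n)}

theorem norm_le_of_mem_finsetSum {ι : Type*} {A : ι → Set (RSpace n)} {r : ι → ℝ} {s : Finset ι}
    (h : ∀ i ∈ s, ∀ x ∈ A i, ‖x‖ ≤ r i) {x : RSpace n} (hx : x ∈ ∑ i ∈ s, A i) :
    ‖x‖ ≤ ∑ i ∈ s, r i := by
  classical
  obtain ⟨g, hg, rfl⟩ := (Set.mem_finsetSum _ _ _).1 hx
  exact (norm_sum_le _ _).trans (Finset.sum_le_sum fun i hi => h i hi _ (hg hi))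

theorem volumeRadius_le_of_forall_norm_le (hn : n ≠ 0) {A : Set (RSpace n)} {r : ℝ} (hr : 0 ≤ r)
    (h : ∀ x ∈ A, ‖x‖ ≤ r) :
    volumeRadius A ≤ r * volumeRadius (Metric.closedBall (0 : RSpace n) 1) := by
  rw [← volumeRadius_smul hn hr, smul_unitClosedBall, Real.norm_of_nonneg hr]
  exact volumeRadius_mono (fun x hx => mem_closedBall_zero_iff.2 (h x hx))
    (isCompact_closedBall _ _).measure_ne_top

theorem volumeRadius_empiricalMean {Ω : Type*} {Ks : ℕ → Ω → ClosedSets (RSpace n)} (hn : n ≠ 0)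
    (M : ℕ) (ω : Ω) :
    volumeRadius (empiricalMean Ks M ω) =
      (M : ℝ)⁻¹ * volumeRadius (∑ i ∈ Finset.range M, (Ks i ω).toSet) :=
  volumeRadius_smul hn (by positivity) _

theorem ae_forall_convexBody (hKs : ∀ i, IsRandomCompactConvex P (Ks i)) :
    ∀ᵐ ω ∂P, (∀ i, (Ks i ω).toSet.Nonempty) ∧ (∀ i, IsCompact (Ks i ω).toSet) ∧
      ∀ i, Convex ℝ (Ks i ω).toSet :=
  (ae_all_iff.2 fun i => (hKs i).ae_nonempty).and
    ((ae_all_iff.2 fun i => (hKs i).ae_isCompact).and (ae_all_iff.2 fun i => (hKs i).ae_convex))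

/-- The values of the support function on a sequence of vectors. -/
noncomputable def supportSeq (d : ℕ → RSpace n) (F : ClosedSets (RSpace n)) : ℕ → ℝ :=
  fun k => supportFn F.toSet (d k)

theorem measurable_supportSeq (d : ℕ → RSpace n) : Measurable (supportSeq d) :=
  measurable_pi_lambda _ fun k => ClosedSets.measurable_supportFn (d k)

/-- Support functions add under Minkowski sums and determine the body on a dense sequence, so the
volume radius is a fixed measurable function of a sum of random sequences. -/
theorem volumeRadius_finsetSum_ae_eq (hKs : ∀ i, IsRandomCompactConvex P (Ks i))
    {d : ℕ → RSpace n} (hd : DenseRange d) (s : Finset ℕ) :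
    (fun ω => volumeRadius (∑ i ∈ s, (Ks i ω).toSet)) =ᵐ[P]
      fun ω => volumeRadius (halfspaceInter d ((∑ i ∈ s, supportSeq d ∘ Ks i) ω)) := by
  filter_upwards [ae_forall_convexBody hKs] with ω ⟨h0, hc, hcv⟩
  rw [← halfspaceInter_supportFn (isCompact_finsetSum fun i _ => hc i)
    (convex_finsetSum fun i _ => hcv i) (nonempty_finsetSum fun i _ => h0 i) hd]
  congr 2
  ext k
  rw [supportFn_finsetSum (fun i _ => hc i) (fun i _ => h0 i)]
  simp [supportSeq]

theorem measurable_finsetSum_supportSeq (hKs : ∀ i, IsRandomCompactConvex P (Ks i))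
    (d : ℕ → RSpace n) (s : Finset ℕ) : Measurable (∑ i ∈ s, supportSeq d ∘ Ks i) := by
  rw [Finset.sum_fn]
  exact Finset.measurable_sum _ fun i _ => (measurable_supportSeq d).comp (hKs i).measurable

theorem aemeasurable_volumeRadius_finsetSum (hKs : ∀ i, IsRandomCompactConvex P (Ks i))
    (s : Finset ℕ) : AEMeasurable (fun ω => volumeRadius (∑ i ∈ s, (Ks i ω).toSet)) P :=
  ⟨_, (measurable_volumeRadius_halfspaceInter _).comp (measurable_finsetSum_supportSeq hKs _ s),
    volumeRadius_finsetSum_ae_eq hKs (TopologicalSpace.denseRange_denseSeq (RSpace n)) s⟩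

/-- The expected volume radius of a Minkowski sum of independent identically distributed random
sets depends only on the number of the summands. -/
theorem integral_volumeRadius_finsetSum_eq [IsProbabilityMeasure P]
    (hKs : ∀ i, IsRandomCompactConvex P (Ks i)) (hindep : iIndepFun Ks P)
    (hident : ∀ i, IdentDistrib (Ks i) K P P) {s t : Finset ℕ} (h : s.card = t.card) :
    ∫ ω, volumeRadius (∑ i ∈ s, (Ks i ω).toSet) ∂P =
      ∫ ω, volumeRadius (∑ i ∈ t, (Ks i ω).toSet) ∂P := by
  set d := TopologicalSpace.denseSeq (RSpace n)
  have hd : DenseRange d := TopologicalSpace.denseRange_denseSeq (RSpace n)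
  have hm := measurable_supportSeq d
  have hmap := map_finsetSum_eq_of_card_eq (P := P) (X := fun i => supportSeq d ∘ Ks i)
    (fun i => hm.comp (hKs i).measurable) (hindep.comp (fun _ => supportSeq d) fun _ => hm)
    (fun i j => (((hident i).trans (hident j).symm).comp hm).map_eq) h
  rw [integral_congr_ae (volumeRadius_finsetSum_ae_eq hKs hd s),
    integral_congr_ae (volumeRadius_finsetSum_ae_eq hKs hd t),
    ← integral_map (f := fun h => volumeRadius (halfspaceInter d h))
      (measurable_finsetSum_supportSeq hKs d s).aemeasurable
      (measurable_volumeRadius_halfspaceInter d).aestronglyMeasurable,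
    ← integral_map (f := fun h => volumeRadius (halfspaceInter d h))
      (measurable_finsetSum_supportSeq hKs d t).aemeasurable
      (measurable_volumeRadius_halfspaceInter d).aestronglyMeasurable, hmap]

theorem integrable_toReal_setNorm_of_identDistrib (hK : IsRandomCompactConvex P K)
    {K' : Ω → ClosedSets (RSpace n)} (h : IdentDistrib K' K P P)
    (hnorm : ∫⁻ ω, setNorm (K ω).toSet ∂P < ∞) :
    Integrable (fun ω => (setNorm (K' ω).toSet).toReal) P :=
  (h.comp ClosedSets.measurable_setNorm.ennreal_toReal).integrable_iff.2
    (hK.integrable_toReal_setNorm hnorm)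

theorem volumeRadius_finsetSum_le (hn : n ≠ 0) (hKs : ∀ i, IsRandomCompactConvex P (Ks i)) :
    ∀ᵐ ω ∂P, ∀ s : Finset ℕ, volumeRadius (∑ i ∈ s, (Ks i ω).toSet) ≤
      (∑ i ∈ s, (setNorm (Ks i ω).toSet).toReal) *
        volumeRadius (Metric.closedBall (0 : RSpace n) 1) := by
  filter_upwards [ae_forall_convexBody hKs] with ω ⟨_, hc, _⟩ s
  exact volumeRadius_le_of_forall_norm_le hn (Finset.sum_nonneg fun i _ => ENNReal.toReal_nonneg)
    fun x => norm_le_of_mem_finsetSum fun i _ x hx => norm_le_toReal_setNorm (hc i) hx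

theorem integrable_volumeRadius_finsetSum (hn : n ≠ 0) (hK : IsRandomCompactConvex P K)
    (hKs : ∀ i, IsRandomCompactConvex P (Ks i)) (hident : ∀ i, IdentDistrib (Ks i) K P P)
    (hnorm : ∫⁻ ω, setNorm (K ω).toSet ∂P < ∞) (s : Finset ℕ) :
    Integrable (fun ω => volumeRadius (∑ i ∈ s, (Ks i ω).toSet)) P := by
  refine ((integrable_finsetSum s fun i _ =>
    integrable_toReal_setNorm_of_identDistrib hK (hident i) hnorm).mul_const
      (volumeRadius (Metric.closedBall (0 : RSpace n) 1))).mono'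
    (aemeasurable_volumeRadius_finsetSum hKs s).aestronglyMeasurable ?_
  filter_upwards [volumeRadius_finsetSum_le hn hKs] with ω h
  rw [Real.norm_of_nonneg (volumeRadius_nonneg _)]
  exact h s

/-- Leaving out any index gives a sum of `M` sets with the same expected volume radius `I_M`, so
Brunn–Minkowski yields `(M + 1) * I_M ≤ M * I_{M+1}`; division by `M * (M + 1)` finishes. -/
theorem integral_volumeRadius_empiricalMean_le_succ [IsProbabilityMeasure P] (hn : n ≠ 0)
    (hK : IsRandomCompactConvex P K)
    (hKs : ∀ i, IsRandomCompactConvex P (Ks i)) (hindep : iIndepFun Ks P)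
    (hident : ∀ i, IdentDistrib (Ks i) K P P) (hnorm : ∫⁻ ω, setNorm (K ω).toSet ∂P < ∞)
    {M : ℕ} (hM : 1 ≤ M) :
    ∫ ω, volumeRadius (empiricalMean Ks M ω) ∂P ≤
      ∫ ω, volumeRadius (empiricalMean Ks (M + 1) ω) ∂P := by
  have hint := integrable_volumeRadius_finsetSum hn hK hKs hident hnorm
  simp only [volumeRadius_empiricalMean hn, integral_const_mul]
  set s := Finset.range (M + 1) with hs
  have h1 : ∑ i ∈ s, ∫ ω, volumeRadius (∑ j ∈ s.erase i, (Ks j ω).toSet) ∂P ≤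
      (M : ℝ) * ∫ ω, volumeRadius (∑ j ∈ s, (Ks j ω).toSet) ∂P := by
    rw [← integral_finsetSum _ fun i _ => hint _, ← integral_const_mul]
    refine integral_mono_ae (integrable_finsetSum _ fun i _ => hint _) ((hint _).const_mul _) ?_
    filter_upwards [ae_forall_convexBody hKs] with ω ⟨h0, hc, hcv⟩
    simpa [hs] using sum_volumeRadius_sum_erase_le hn s (fun i _ => hc i) (fun i _ => h0 i)
      fun i _ => hcv i
  have h2 : ∀ i ∈ s, ∫ ω, volumeRadius (∑ j ∈ s.erase i, (Ks j ω).toSet) ∂P =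
      ∫ ω, volumeRadius (∑ j ∈ Finset.range M, (Ks j ω).toSet) ∂P := fun i hi =>
    integral_volumeRadius_finsetSum_eq hKs hindep hident (by
      rw [Finset.card_erase_of_mem hi, hs, Finset.card_range, Finset.card_range, Nat.add_sub_cancel])
  rw [Finset.sum_congr rfl h2, Finset.sum_const, nsmul_eq_mul, hs, Finset.card_range] at h1
  have hM' : (0 : ℝ) < M := by exact_mod_cast hM
  rw [inv_mul_le_iff₀ hM', ← mul_assoc, mul_comm (M : ℝ), mul_assoc, le_inv_mul_iff₀ (by positivity)]
  exact h1

/-- Countably many real strong laws suffice: one for each direction `d k`, and one for the norms. -/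
theorem ae_tendsto_volumeRadius_empiricalMean [IsProbabilityMeasure P] (hn : n ≠ 0)
    (hK : IsRandomCompactConvex P K)
    (hKs : ∀ i, IsRandomCompactConvex P (Ks i)) (hindep : iIndepFun Ks P)
    (hident : ∀ i, IdentDistrib (Ks i) K P P) (hnorm : ∫⁻ ω, setNorm (K ω).toSet ∂P < ∞) :
    ∀ᵐ ω ∂P, Tendsto (fun M => volumeRadius (empiricalMean Ks M ω)) atTop
      (𝓝 (volumeRadius (closure (aumannExpectation P K)))) := by
  set d := TopologicalSpace.denseSeq (RSpace n)
  have hd : DenseRange d := TopologicalSpace.denseRange_denseSeq (RSpace n)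
  have hlaw : ∀ {g : ClosedSets (RSpace n) → ℝ}, Measurable g → Integrable (fun ω => g (K ω)) P →
      ∀ᵐ ω ∂P, Tendsto (fun M : ℕ => (M : ℝ)⁻¹ * ∑ i ∈ Finset.range M, g (Ks i ω)) atTop
        (𝓝 (∫ ω, g (K ω) ∂P)) := by
    intro g hg hint
    have := strong_law_ae (μ := P) (fun i => g ∘ Ks i) (((hident 0).comp hg).integrable_iff.2 hint)
      (fun i j hij => (hindep.indepFun hij).comp hg hg)
      (fun i => ((hident i).trans (hident 0).symm).comp hg)
    rw [((hident 0).comp hg).integral_eq] at this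
    exact this
  filter_upwards [ae_forall_convexBody hKs,
    ae_all_iff.2 fun k => hlaw (ClosedSets.measurable_supportFn (d k))
      (hK.integrable_supportFn hnorm (d k)),
    hlaw ClosedSets.measurable_setNorm.ennreal_toReal (hK.integrable_toReal_setNorm hnorm)]
    with ω ⟨h0, hc, hcv⟩ hsupp hsn
  -- The averages of the norms converge, hence are bounded; this puts all the means in one ball.
  obtain ⟨R, hR⟩ := hsn.bddAbove_range
  have hsc : ∀ M : ℕ, IsCompact (∑ i ∈ Finset.range M, (Ks i ω).toSet) := fun M =>
    isCompact_finsetSum fun i _ => hc i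
  have hs0 : ∀ M : ℕ, (∑ i ∈ Finset.range M, (Ks i ω).toSet).Nonempty := fun M =>
    nonempty_finsetSum fun i _ => h0 i
  refine tendsto_volumeRadius_of_tendsto_supportFn (A := fun M => empiricalMean Ks M ω) hn hd
    (fun M => (hsc M).smul _) (fun M => (hs0 M).smul_set)
    (fun M => (convex_finsetSum fun i _ => hcv i).smul _)
    (hK.isCompact_closure_aumannExpectation hnorm) (hK.aumannExpectation_nonempty hnorm).closure
    hK.convex_aumannExpectation.closure (R := R) ?_ ?_
  · rintro M _ ⟨x, hx, rfl⟩
    refine le_trans ?_ (hR ⟨M, rfl⟩)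
    rw [norm_smul, Real.norm_of_nonneg (by positivity)]
    exact mul_le_mul_of_nonneg_left (norm_le_of_mem_finsetSum
      (fun i _ x hx => norm_le_toReal_setNorm (hc i) hx) hx) (by positivity)
  · intro k
    rw [hK.supportFn_closure_aumannExpectation hnorm]
    refine (hsupp k).congr fun M => ?_
    rw [empiricalMean, supportFn_smul (hsc M) (hs0 M) (by positivity),
      supportFn_finsetSum (fun i _ => hc i) fun i _ => h0 i]

/-- The dominating averages of norms vary with `M`, so dominated convergence is used in the form
that allows an `L¹`-convergent bound. -/
theorem tendsto_integral_volumeRadius_empiricalMean [IsProbabilityMeasure P] (hn : n ≠ 0)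
    (hK : IsRandomCompactConvex P K)
    (hKs : ∀ i, IsRandomCompactConvex P (Ks i)) (hindep : iIndepFun Ks P)
    (hident : ∀ i, IdentDistrib (Ks i) K P P) (hnorm : ∫⁻ ω, setNorm (K ω).toSet ∂P < ∞) :
    Tendsto (fun M => ∫ ω, volumeRadius (empiricalMean Ks M ω) ∂P) atTop
      (𝓝 (volumeRadius (closure (aumannExpectation P K)))) := by
  set c := volumeRadius (Metric.closedBall (0 : RSpace n) 1)
  have hc0 : 0 ≤ c := volumeRadius_nonneg _
  set g : ClosedSets (RSpace n) → ℝ := fun F => (setNorm F.toSet).toReal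
  have hg : Measurable g := ClosedSets.measurable_setNorm.ennreal_toReal
  have hint : ∀ i, Integrable (g ∘ Ks i) P := fun i =>
    integrable_toReal_setNorm_of_identDistrib hK (hident i) hnorm
  have hL1 := tendsto_integral_abs_average_sub (X := fun i => g ∘ Ks i) (hint 0)
    (fun i j hij => (hindep.indepFun hij).comp hg hg)
    (fun i => ((hident i).trans (hident 0).symm).comp hg)
  have hmean : ∫ ω, (g ∘ Ks 0) ω ∂P = ∫ ω, g (K ω) ∂P := ((hident 0).comp hg).integral_eq
  rw [hmean] at hL1
  refine tendsto_integral_of_le_of_tendsto_integral_abs_sub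
    (S := fun M ω => c * ((M : ℝ)⁻¹ * ∑ i ∈ Finset.range M, (g ∘ Ks i) ω))
    (σ := c * ∫ ω, g (K ω) ∂P) (fun M => ?_)
    (fun M => ((integrable_finsetSum _ fun i _ => hint i).const_mul _).const_mul c)
    (fun M => Eventually.of_forall fun ω => volumeRadius_nonneg _) (fun M => ?_) ?_
    (ae_tendsto_volumeRadius_empiricalMean hn hK hKs hindep hident hnorm) ?_
  · simp only [volumeRadius_empiricalMean hn]
    exact (integrable_volumeRadius_finsetSum hn hK hKs hident hnorm _).const_mul _
  · filter_upwards [volumeRadius_finsetSum_le hn hKs] with ω h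
    rw [volumeRadius_empiricalMean hn, mul_left_comm]
    refine mul_le_mul_of_nonneg_left ?_ (by positivity)
    rw [mul_comm]
    exact h _
  -- The limit is at most `σ` because the Aumann expectation lies in the ball of radius `E‖K‖`.
  · rw [mul_comm]
    refine volumeRadius_le_of_forall_norm_le hn (integral_nonneg fun _ => ENNReal.toReal_nonneg) ?_
    intro x hx
    rw [← mem_closedBall_zero_iff]
    exact closure_minimal (fun y hy => mem_closedBall_zero_iff.2
      (hK.norm_le_of_mem_aumannExpectation hnorm hy)) Metric.isClosed_closedBall hx
  · simpa only [← mul_sub, abs_mul, abs_of_nonneg hc0, integral_const_mul, mul_zero]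
      using hL1.const_mul c

end RandomSets

/-! ### The main theorem. -/

theorem theorem4p5 {n : ℕ} (hn : 1 ≤ n) {Ω : Type*} [MeasurableSpace Ω]
    (P : Measure Ω) [IsProbabilityMeasure P]
    (K : Ω → ClosedSets (RSpace n)) (Ks : ℕ → Ω → ClosedSets (RSpace n))
    (hK : IsRandomCompactConvex P K) (hKs : ∀ i, IsRandomCompactConvex P (Ks i))
    (hindep : iIndepFun Ks P) (hident : ∀ i, IdentDistrib (Ks i) K P P)
    (hnorm : ∫⁻ ω, setNorm (K ω).toSet ∂P < ∞) :
    (∀ M : ℕ, 1 ≤ M → Integrable (fun ω => volumeRadius (empiricalMean Ks M ω)) P) ∧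
    MonotoneOn (fun M : ℕ => ∫ ω, volumeRadius (empiricalMean Ks M ω) ∂P) (Set.Ici 1) ∧
    volume (aumannExpectation P K) < ∞ ∧
    Tendsto (fun M : ℕ => ∫ ω, volumeRadius (empiricalMean Ks M ω) ∂P) atTop
      (𝓝 (volumeRadius (aumannExpectation P K))) := by
  have hn' : n ≠ 0 := by omega
  have hvol := hK.volume_closure_aumannExpectation
  refine ⟨fun M _ => ?_, ?_, ?_, ?_⟩
  · simp only [volumeRadius_empiricalMean hn']
    exact (integrable_volumeRadius_finsetSum hn' hK hKs hident hnorm _).const_mul _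
  · intro M hM N _ hMN
    induction N, hMN using Nat.le_induction with
    | base => exact le_rfl
    | succ N hMN ih =>
      exact (ih (le_trans hM hMN)).trans (integral_volumeRadius_empiricalMean_le_succ hn' hK hKs
        hindep hident hnorm (le_trans hM hMN))
  · rw [← hvol]
    exact (hK.isCompact_closure_aumannExpectation hnorm).measure_lt_top
  · have := tendsto_integral_volumeRadius_empiricalMean hn' hK hKs hindep hident hnorm
    rwa [volumeRadius, measureReal_def, hvol] at this
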